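/- **Setting.** Let $\Delta$ be a finite ranked alphabet, $N$ a finite set of nonterminals and $N'\subseteq N$. A regular tree grammar over $\Delta$ and $N$ is a tuple $G=(S,N,\Delta,P)$ with $S\in N$ and a finite list $P$ of productions $A\to\alpha$, where $A\in N$ and $\alpha$ is a term over $\Delta\cup N$ (nonterminals being nullary); $L(G)$ is the set of $\Delta$-terms derivable from $S$ in finitely many steps. A *base language* consists of a regular tree grammar $G'=(S',N',\Delta,P')$, a set $\mathcal M$ of (finitely encoded) examples and a predicate $\mathsf{consistent}\subseteq L(G')\times\mathcal M$. Assume that its semantics can be evaluated over fixed structures by tree automata: from each $M\in\mathcal M$ one can compute nondeterministic top-down tree automata $A_M$, $A_{\neg M}$ with $L(A_M)=\{e\in L(G'):\mathsf{consistent}(e,M)\}$ and $L(A_{\neg M})=\{e\in L(G'):\neg\,\mathsf{consistent}(e,M)\}$. A grammar $G=(S,N,\Delta,P)$, presented so that the first production in the list $P$ is one for $S$, is encoded as a tree $\mathsf{enc}(G)=\mathsf{root}(\mathsf{enc}_p(P))$ over the ranked alphabet $\Gamma(\Delta,N)=\Delta\sqcup\{\mathsf{root}^1,\mathsf{end}^0\}\sqcup\{\mathsf{lhs}_A^2,\mathsf{rhs}_A^0: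 A\in N\}$, where $\mathsf{enc}_p$ of the empty list is $\mathsf{end}$, $\mathsf{enc}_p$ of the list with first production $A\to\alpha$ and remaining list $P_1$ is $\mathsf{lhs}_A(\mathsf{enc}_t(\alpha),\mathsf{enc}_p(P_1))$, and $\mathsf{enc}_t(\alpha)$ replaces each nonterminal $A$ in $\alpha$ by $\mathsf{rhs}_A$. Put $\mathsf{extend}(G,G')=(S,N,\Delta,P\cup P')$. **Adequate DSL synthesis problem** (for fixed $N$ and fixed base language). *Input:* learning instances $I_1,\dots,I_l$, each a pair $I_p=(X_p,Y_p)$ of finite sets of examples (training and testing), and a meta-grammar $\mathcal G$, that is, a regular tree grammar over $\Gamma(\Delta,N)$. *Output:* a grammar $G=(S,N,\Delta,P)$ as above (a *solution*) such that 1. for each $p$ there is an expression $e\in L(G')$ with $e\in L(\mathsf{extend}(G,G'))$ and $\mathsf{consistent}(e,M)$ for all $M\in X_p\cup Y_p$; and 2. $\mathsf{enc}(G)\in L(\mathcal G)$. **Theorem.** Under the assumption above, the adequate DSL synthesis problem is decidable and solutions can be synthesized: there is an algorithm that decides, given $I_1,\dots,I_l$ and $\mathcal G$, whether a solution exists, and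 an algorithm that outputs a solution if there is one and otherwise reports that there is none. Furthermore, for all $I_1,\dots,I_l$ and $\mathcal G$, the set $\{\mathsf{enc}(G) : G \text{ is a solution}\}$ is a regular set of trees (it is the language of a tree automaton). -/

import Mathlib

namespace DSLSynth

/-! ### Terms over a ranked alphabet

A ranked alphabet is a type `Δ` of symbols with an arity function `ar : Δ → ℕ`. -/

/-- `Term ar X` is the set `T_Δ(X)` of terms over the ranked alphabet `(Δ, ar)` with additional
nullary symbols from `X`. -/
inductive Term {Δ : Type*} (ar : Δ → ℕ) (X : Type*) where
  | var (x : X) : Term ar X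
  | app (f : Δ) (ts : Fin (ar f) → Term ar X) : Term ar X

/-- `T_Δ`, the terms (trees) over the ranked alphabet `(Δ, ar)`. -/
abbrev Tree {Δ : Type*} (ar : Δ → ℕ) := Term ar Empty

namespace Term

variable {Δ X Y : Type*} {ar : Δ → ℕ}

/-- Renaming of the additional nullary symbols. -/
def map (g : X → Y) : Term ar X → Term ar Y
  | var x => var (g x)
  | app f ts => app f fun i => (ts i).map g

/-- The inclusion `T_Δ ⊆ T_Δ(X)`. -/
def ofTree (t : Tree ar) : Term ar X := t.map Empty.elim

/-! #### Terms as data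

Terms are encoded by their Polish notation, which makes `Term ar X` a `Primcodable` type. -/

/-- Polish (prefix) notation. -/
def word : Term ar X → List (X ⊕ Δ)
  | var x => [Sum.inl x]
  | app f ts => Sum.inr f :: (List.ofFn fun i => (ts i).word).flatten

/-- One step of the right-to-left parser of Polish notation, on a stack of terms. -/
def parseStep (s : X ⊕ Δ) (st : Option (List (Term ar X))) : Option (List (Term ar X)) :=
  st.bind fun l => match s with
    | Sum.inl x => some (var x :: l)
    | Sum.inr f =>
      if h : ar f ≤ l.length then
        some (app f (fun i => l[i.1]'(lt_of_lt_of_le i.2 h)) :: l.drop (ar f))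
      else none

/-- The stack of terms obtained by parsing a word from right to left. -/
def parse (w : List (X ⊕ Δ)) : Option (List (Term ar X)) := w.foldr parseStep (some [])

/-- The parser, with the stack replaced by its length. -/
def countStep (ar : Δ → ℕ) (s : X ⊕ Δ) (st : Option ℕ) : Option ℕ :=
  st.bind fun n => Sum.casesOn s (fun _ => some (n + 1))
    (fun f => if ar f ≤ n then some (n - ar f + 1) else none)

/-- The words that are the Polish notation of a term. -/
def WellFormed (ar : Δ → ℕ) (w : List (X ⊕ Δ)) : Prop :=
  w.foldr (countStep ar) (some 0) = some 1

theorem foldr_flatten_word (ts : List (Term ar X))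
    (ih : ∀ t ∈ ts, ∀ l : List (Term ar X), t.word.foldr parseStep (some l) = some (t :: l))
    (l : List (Term ar X)) :
    (ts.map word).flatten.foldr parseStep (some l) = some (ts ++ l) := by
  induction ts with
  | nil => rfl
  | cons t ts iht =>
    rw [List.map_cons, List.flatten_cons, List.foldr_append,
      iht fun t' h' => ih t' (List.mem_cons_of_mem _ h'), ih t List.mem_cons_self]
    rfl

theorem foldr_word (t : Term ar X) :
    ∀ l : List (Term ar X), t.word.foldr parseStep (some l) = some (t :: l) := by
  induction t with
  | var x => intro l; rfl
  | app f ts ih =>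
    intro l
    have h := foldr_flatten_word (List.ofFn ts) (by
      intro t ht
      obtain ⟨i, rfl⟩ := List.mem_ofFn.1 ht
      exact ih i) l
    rw [List.map_ofFn] at h
    change parseStep (Sum.inr f) ((List.ofFn (word ∘ ts)).flatten.foldr parseStep (some l)) = _
    rw [h]
    simp [parseStep]

theorem flatten_word_of_parse (w : List (X ⊕ Δ)) :
    ∀ l : List (Term ar X), parse w = some l → (l.map word).flatten = w := by
  induction w with
  | nil =>
    intro l h
    cases h
    rfl
  | cons s w ih =>
    intro l h
    change parseStep s (parse w) = some l at h
    cases hp : parse (ar := ar) w with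
    | none => simp [hp, parseStep] at h
    | some m =>
      have hm := ih m hp
      rw [hp] at h
      cases s with
      | inl x =>
        simp only [parseStep, Option.bind_some, Option.some.injEq] at h
        subst h
        simp [word, hm]
      | inr f =>
        simp only [parseStep, Option.bind_some] at h
        split at h
        · rename_i hle
          simp only [Option.some.injEq] at h
          subst h
          have ht : (List.ofFn fun i : Fin (ar f) =>
              (m[i.1]'(lt_of_lt_of_le i.2 hle)).word) = (m.take (ar f)).map word := by
            apply List.ext_getElem
            · simp [hle]
            · intro i h1 h2
              simp
          rw [List.map_cons, List.flatten_cons, word, ht, List.cons_append, ← List.flatten_append,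
            ← List.map_append, List.take_append_drop, hm]
        · cases h

theorem count_eq_parse (w : List (X ⊕ Δ)) :
    w.foldr (countStep ar) (some 0) = (parse (ar := ar) w).map List.length := by
  induction w with
  | nil => rfl
  | cons s w ih =>
    change countStep ar s (w.foldr (countStep ar) (some 0)) =
      (parseStep s (parse (ar := ar) w)).map List.length
    rw [ih]
    cases parse (ar := ar) w with
    | none => rfl
    | some m =>
      cases s with
      | inl x => rfl
      | inr f =>
        simp only [countStep, parseStep, Option.map_some, Option.bind_some]
        split <;> simp

theorem parse_word (t : Term ar X) : parse t.word = some [t] := foldr_word t []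

theorem wellFormed_word (t : Term ar X) : WellFormed ar t.word := by
  rw [WellFormed, count_eq_parse, parse_word]
  rfl

theorem word_injective : Function.Injective (word : Term ar X → List (X ⊕ Δ)) := by
  intro s t h
  have h' := parse_word s
  rw [h, parse_word t] at h'
  simpa using h'.symm

theorem exists_word {w : List (X ⊕ Δ)} (hw : WellFormed ar w) :
    ∃ t : Term ar X, t.word = w := by
  rw [WellFormed, count_eq_parse] at hw
  obtain ⟨l, hl, h1⟩ := Option.map_eq_some_iff.1 hw
  obtain ⟨t, rfl⟩ := List.length_eq_one_iff.1 h1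
  exact ⟨t, by simpa using flatten_word_of_parse w _ hl⟩

/-- Terms are the same as well-formed words in Polish notation. -/
noncomputable def equivWord : Term ar X ≃ {w : List (X ⊕ Δ) // WellFormed ar w} :=
  Equiv.ofBijective (fun t => ⟨t.word, wellFormed_word t⟩)
    ⟨fun _ _ h => word_injective (congrArg Subtype.val h),
      fun w => (exists_word w.2).imp fun _ h => Subtype.ext h⟩

instance instDecidableWellFormed : DecidablePred (WellFormed ar : List (X ⊕ Δ) → Prop) :=
  fun w => inferInstanceAs (Decidable (w.foldr (countStep ar) (some 0) = some 1))

theorem primrec_countStep [Finite Δ] [Primcodable Δ] [Primcodable X] :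
    Primrec₂ (countStep ar : X ⊕ Δ → Option ℕ → Option ℕ) := by
  have har : Primrec ar := Primrec.dom_finite ar
  unfold countStep
  refine Primrec.option_bind Primrec.snd (Primrec.sumCasesOn (Primrec.fst.comp Primrec.fst) ?_ ?_)
  · exact (Primrec.option_some.comp (Primrec.succ.comp (Primrec.snd.comp Primrec.fst))).to₂
  · refine Primrec.ite (Primrec.nat_le.comp (har.comp Primrec.snd)
      (Primrec.snd.comp Primrec.fst)) ?_ (Primrec.const none)
    exact Primrec.option_some.comp (Primrec.succ.comp (Primrec.nat_sub.comp
      (Primrec.snd.comp Primrec.fst) (har.comp Primrec.snd)))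

theorem primrecPred_wellFormed [Finite Δ] [Primcodable Δ] [Primcodable X] :
    PrimrecPred (WellFormed ar : List (X ⊕ Δ) → Prop) :=
  Primrec.eq.comp
    (Primrec.list_foldr Primrec.id (Primrec.const (some 0))
      (primrec_countStep.comp (Primrec.fst.comp Primrec.snd) (Primrec.snd.comp Primrec.snd)).to₂)
    (Primrec.const (some 1))

noncomputable instance instPrimcodable [Finite Δ] [Primcodable Δ] [Primcodable X] :
    Primcodable (Term ar X) :=
  letI := Primcodable.subtype (primrecPred_wellFormed (ar := ar) (X := X))
  Primcodable.ofEquiv _ equivWord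

end Term

/-! ### Regular tree grammars -/

/-- A regular tree grammar `(S, N, Δ, P)`: a start nonterminal and a finite list of productions
`A → α` with `A ∈ N` and `α ∈ T_Δ(N)`. -/
structure Grammar {Δ : Type*} (ar : Δ → ℕ) (N : Type*) where
  start : N
  prods : List (N × Term ar N)

namespace Grammar

variable {Δ N N' : Type*} {ar : Δ → ℕ}

/-- One derivation step: an occurrence of a nonterminal is replaced by the right-hand side of one
of its productions. -/
inductive Step (P : List (N × Term ar N)) : Term ar N → Term ar N → Prop
  | rule {A : N} {α : Term ar N} (h : (A, α) ∈ P) : Step P (Term.var A) α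
  | arg {f : Δ} (ts : Fin (ar f) → Term ar N) (i : Fin (ar f)) {s : Term ar N}
      (h : Step P (ts i) s) : Step P (Term.app f ts) (Term.app f (Function.update ts i s))

/-- `L(G) ⊆ T_Δ`: the terms without nonterminals that are derivable from the start nonterminal in
finitely many steps. -/
def language (G : Grammar ar N) : Set (Tree ar) :=
  {t | Relation.ReflTransGen (Step G.prods) (Term.var G.start) t.ofTree}

/-- Regard a grammar over the nonterminals `N' ⊆ N` as a list of productions over `N`. -/
def liftProds {N' : Set N} (G' : Grammar ar N') : List (N × Term ar N) :=
  G'.prods.map fun p => (p.1.1, p.2.map Subtype.val)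

/-- `extend(G, G') = (S, N, Δ, P ∪ P')`. -/
def extend {N' : Set N} (G : Grammar ar N) (G' : Grammar ar N') : Grammar ar N where
  start := G.start
  prods := G.prods ++ G'.liftProds

/-- Grammars as data. -/
def equivProd : Grammar ar N ≃ N × List (N × Term ar N) where
  toFun G := (G.start, G.prods)
  invFun p := ⟨p.1, p.2⟩
  left_inv _ := rfl
  right_inv _ := rfl

noncomputable instance instPrimcodable [Finite Δ] [Primcodable Δ] [Primcodable N] :
    Primcodable (Grammar ar N) :=
  Primcodable.ofEquiv _ equivProd

end Grammar

/-! ### Tree automata -/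

/-- A nondeterministic top-down tree automaton `(Q, Δ, Qⁱ, δ)`. States are natural numbers (only the
finitely many that are mentioned matter); `(q, f, [q₁, …, qᵣ]) ∈ trans` is the transition
`q(f) → q₁ ⋯ qᵣ`, where `r` is the arity of `f` (a triple whose list has another length is never
applicable). -/
structure TreeAutomaton (Δ : Type*) where
  initial : List ℕ
  trans : List (ℕ × Δ × List ℕ)

namespace TreeAutomaton

variable {Δ : Type*}

/-- There is an accepting run on the tree from the given state. -/
inductive Run (ar : Δ → ℕ) (A : TreeAutomaton Δ) : ℕ → Tree ar → Prop
  | app {q : ℕ} {f : Δ} (qs : Fin (ar f) → ℕ) (ts : Fin (ar f) → Tree ar)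
      (h : (q, f, List.ofFn qs) ∈ A.trans) (hs : ∀ i, Run ar A (qs i) (ts i)) :
      Run ar A q (Term.app f ts)

/-- The set of trees accepted by the automaton. -/
def language (ar : Δ → ℕ) (A : TreeAutomaton Δ) : Set (Tree ar) :=
  {t | ∃ q ∈ A.initial, Run ar A q t}

/-- Tree automata as data. -/
def equivProd : TreeAutomaton Δ ≃ List ℕ × List (ℕ × Δ × List ℕ) where
  toFun A := (A.initial, A.trans)
  invFun p := ⟨p.1, p.2⟩
  left_inv _ := rfl
  right_inv _ := rfl

instance instPrimcodable [Primcodable Δ] : Primcodable (TreeAutomaton Δ) :=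
  Primcodable.ofEquiv _ equivProd

end TreeAutomaton

/-- A regular tree language: the set of trees accepted by some tree automaton. -/
def IsRegularTreeLanguage {Δ : Type*} (ar : Δ → ℕ) (L : Set (Tree ar)) : Prop :=
  ∃ A : TreeAutomaton Δ, A.language ar = L

/-! ### Encoding grammars as trees -/

/-- The symbols of the grammar alphabet `Γ(Δ, N)`, for nonterminals without parameters. -/
inductive GrammarSymbol (Δ N : Type*) where
  | base (f : Δ)
  | rootSym
  | endSym
  | lhs (A : N)
  | rhs (A : N)

namespace GrammarSymbol

variable {Δ N : Type*}

/-- The arities of the symbols of `Γ(Δ, N)`. -/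
def arity (ar : Δ → ℕ) : GrammarSymbol Δ N → ℕ
  | base f => ar f
  | rootSym => 1
  | endSym => 0
  | lhs _ => 2
  | rhs _ => 0

/-- Grammar symbols as data. -/
def equivSum : GrammarSymbol Δ N ≃ (Δ ⊕ Bool) ⊕ (N ⊕ N) where
  toFun
    | base f => Sum.inl (Sum.inl f)
    | rootSym => Sum.inl (Sum.inr true)
    | endSym => Sum.inl (Sum.inr false)
    | lhs A => Sum.inr (Sum.inl A)
    | rhs A => Sum.inr (Sum.inr A)
  invFun
    | Sum.inl (Sum.inl f) => base f
    | Sum.inl (Sum.inr true) => rootSym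
    | Sum.inl (Sum.inr false) => endSym
    | Sum.inr (Sum.inl A) => lhs A
    | Sum.inr (Sum.inr A) => rhs A
  left_inv s := by cases s <;> rfl
  right_inv s := by rcases s with (_ | _ | _) | _ | _ <;> rfl

instance instFinite [Finite Δ] [Finite N] : Finite (GrammarSymbol Δ N) :=
  Finite.of_equiv _ equivSum.symm

instance instPrimcodable [Primcodable Δ] [Primcodable N] : Primcodable (GrammarSymbol Δ N) :=
  Primcodable.ofEquiv _ equivSum

end GrammarSymbol

/-- `T_{Γ(Δ, N)}`. -/
abbrev GrammarTree {Δ : Type*} (ar : Δ → ℕ) (N : Type*) :=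
  Tree (GrammarSymbol.arity ar : GrammarSymbol Δ N → ℕ)

section Encoding

variable {Δ N : Type*} {ar : Δ → ℕ}

/-- Encoding of a right-hand side: a nonterminal `A` becomes `rhs_A`. -/
def encTerm : Term ar N → GrammarTree ar N
  | Term.var A => Term.app (GrammarSymbol.rhs A) Fin.elim0
  | Term.app f ts => Term.app (GrammarSymbol.base f) fun i => encTerm (ts i)

/-- Encoding of a list of productions along a right-going spine. -/
def encProds : List (N × Term ar N) → GrammarTree ar N
  | [] => Term.app GrammarSymbol.endSym Fin.elim0
  | (A, α) :: P => Term.app (GrammarSymbol.lhs A) ![encTerm α, encProds P]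

/-- The grammar tree `enc(G)`. -/
def Grammar.enc (G : Grammar ar N) : GrammarTree ar N :=
  Term.app GrammarSymbol.rootSym ![encProds G.prods]

/-- The convention on the presentation of grammars under which `enc(G)` determines `G`: the
first production in the list is one for the start nonterminal (so the start nonterminal can be read
off from the topmost production of the grammar tree). -/
def Grammar.StartFirst (G : Grammar ar N) : Prop :=
  ∃ α P, G.prods = (G.start, α) :: P

end Encoding

/-- A meta-grammar: a regular tree grammar over `Γ(Δ, N)`. Its own nonterminals are named by natural
numbers. -/
abbrev MetaGrammar {Δ : Type*} (ar : Δ → ℕ) (N : Type*) :=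
  Grammar (GrammarSymbol.arity ar : GrammarSymbol Δ N → ℕ) ℕ

/-! ### Base languages and the adequate DSL synthesis problem -/

/-- A base language: a regular tree grammar `G'` and a predicate
`consistent ⊆ L(G') × 𝓜`, where `𝓜` is the set of examples. -/
structure BaseLanguage {Δ : Type*} (ar : Δ → ℕ) (N' : Type*) (𝓜 : Type*) where
  grammar : Grammar ar N'
  consistent : grammar.language → 𝓜 → Prop

/-- A learning instance `(X, Y)`: finite sets, given as lists, of training and testing
examples. -/
abbrev LearningInstance (𝓜 : Type*) := List 𝓜 × List 𝓜

namespace BaseLanguage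

variable {Δ N 𝓜 : Type*} {ar : Δ → ℕ}

/-- The semantics can be evaluated over fixed structures by tree automata: from an example `M` one
can compute tree automata for the set of expressions consistent with `M` and for the set of
expressions inconsistent with `M`. -/
def TreeAutomatonComputable {N' : Type*} [Primcodable Δ] [Primcodable 𝓜]
    (B : BaseLanguage ar N' 𝓜) : Prop :=
  ∃ A A' : 𝓜 → TreeAutomaton Δ, Computable A ∧ Computable A' ∧
    ∀ M, (A M).language ar = {e | ∃ h : e ∈ B.grammar.language, B.consistent ⟨e, h⟩ M} ∧
      (A' M).language ar = {e | ∃ h : e ∈ B.grammar.language, ¬ B.consistent ⟨e, h⟩ M}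

/-- `solves(e, I)`: the expression `e` is consistent with every example in `X ∪ Y`. -/
def Solves {N' : Type*} (B : BaseLanguage ar N' 𝓜) (e : B.grammar.language)
    (I : LearningInstance 𝓜) : Prop :=
  (∀ M ∈ I.1, B.consistent e M) ∧ (∀ M ∈ I.2, B.consistent e M)

/-- A DSL is adequate if it contains, for each of the instances, an expression that solves it. -/
def Adequate {N' : Type*} (B : BaseLanguage ar N' 𝓜) (Is : List (LearningInstance 𝓜))
    (D : Grammar ar N) : Prop :=
  ∀ I ∈ Is, ∃ e : B.grammar.language, e.1 ∈ D.language ∧ B.Solves e I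

/-- `G` is a solution of the adequate DSL synthesis problem with instances `Is` and meta-grammar
`𝒢`. -/
structure IsSolution {N' : Set N} (B : BaseLanguage ar N' 𝓜) (Is : List (LearningInstance 𝓜))
    (𝒢 : MetaGrammar ar N) (G : Grammar ar N) : Prop where
  startFirst : G.StartFirst
  adequate : B.Adequate Is (G.extend B.grammar)
  enc_mem : G.enc ∈ 𝒢.language

end BaseLanguage

end DSLSynth

/-! The proof replaces automata constructions by finite-index congruences on trees with explicit
index bounds (`Recognizable`). Languages of grammars and automata have such congruences: colour a
tree by the set of right-hand-side subterms that derive it (`recognizable_gen`).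

The core is `recognizable_encLanguage`. Let L be recognizable with colouring c. Whether a grammar
derives an element of L depends only on the pairs (A, k) such that A derives a tree of colour k.
This set is the least set closed under the one-step operator of the productions
(`mem_genColors_iff`), so it is determined by what the operator does to each of the finitely many
sets W of pairs. For a fixed W, these one-step colours can be read off the encoding bottom-up. Hence
the encodings of grammars deriving an element of L form a recognizable set. The encodings of
solutions are the intersection of one such set per instance, the set of encodings under the start
convention, and the meta-grammar language (`recognizable_solutions`). A recognizable set is regular,
with the colours as states.

The algorithm is a bounded search. A nonempty recognizable set has an element of size bounded in
terms of its index (`Recognizable.exists_small`), and the index bounds are primitive recursive in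
the automata. This bounds both the grammars to be tried and, for each grammar, the expressions to be
tried (`exists_solver_iff`). Membership in a tree language is decided by saturating a finite set of
derivability facts about Polish words. Everything is primitive recursive in the automata; computing
them from the examples is merely computable. -/

namespace DSLSynth

/-! ### Recognizable tree languages -/

/-- A sequence of sizes that starts at `0` and increases by at least one in each step has passed `n`
after `n + 1` steps. -/
theorem exists_eq_succ_of_le {f : ℕ → ℕ} (hf : Monotone f) {n : ℕ} (hn : ∀ k, f k ≤ n) :
    ∃ k ≤ n, f k = f (k + 1) := by
  by_contra! h
  have key : ∀ k ≤ n + 1, k ≤ f k := by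
    intro k
    induction k with
    | zero => simp
    | succ k ih =>
      intro hk
      have h1 := ih (by omega)
      have h2 := h k (by omega)
      have h3 : f k ≤ f (k + 1) := hf (Nat.le_succ k)
      omega
  have := key (n + 1) le_rfl
  have := hn (n + 1)
  omega

section Recognizable

variable {Δ : Type*} {ar : Δ → ℕ}

/-- A colouring of trees such that the colour of a tree depends only on its topmost symbol and on the
colours of its children. -/
def IsCongruence {K : Type*} (c : Tree ar → K) : Prop :=
  ∀ (f : Δ) (ts ts' : Fin (ar f) → Tree ar), (∀ i, c (ts i) = c (ts' i)) →
    c (Term.app f ts) = c (Term.app f ts')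

/-- `L` is a union of colour classes of a congruence with at most `n` colours. -/
def Recognizable (ar : Δ → ℕ) (n : ℕ) (L : Set (Tree ar)) : Prop :=
  ∃ c : Tree ar → Fin n, IsCongruence c ∧ ∀ t t', c t = c t' → t ∈ L → t' ∈ L

theorem Recognizable.of_coloring {K : Type*} [Finite K] {n : ℕ} {L : Set (Tree ar)}
    (c : Tree ar → K) (hc : IsCongruence c) (hK : Nat.card K ≤ n)
    (hL : ∀ t t', c t = c t' → t ∈ L → t' ∈ L) : Recognizable ar n L := by
  let g : K → Fin n := fun k => Fin.castLE hK (Finite.equivFin K k)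
  have hg : Function.Injective g :=
    (Fin.castLE_injective hK).comp (Finite.equivFin K).injective
  exact ⟨fun t => g (c t), fun f ts ts' h => congrArg g (hc f ts ts' fun i => hg (h i)),
    fun t t' h => hL t t' (hg h)⟩

/-- A finite family of properties of trees such that the properties of a tree depend only on its
topmost symbol and on the properties of its children. -/
theorem Recognizable.of_properties {O : Type*} [Finite O] {n : ℕ} {L : Set (Tree ar)}
    (ρ : O → Tree ar → Prop)
    (hρ : ∀ (f : Δ) (ts ts' : Fin (ar f) → Tree ar), (∀ i o, ρ o (ts i) ↔ ρ o (ts' i)) →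
      ∀ o, ρ o (Term.app f ts) → ρ o (Term.app f ts'))
    (hn : Nat.card O ≤ n)
    (hL : ∀ t t', (∀ o, ρ o t ↔ ρ o t') → t ∈ L → t' ∈ L) : Recognizable ar (2 ^ n) L := by
  refine Recognizable.of_coloring (fun t => {o | ρ o t}) ?_ ?_ ?_
  · intro f ts ts' h
    have h' : ∀ i o, ρ o (ts i) ↔ ρ o (ts' i) := fun i o => Set.ext_iff.1 (h i) o
    ext o
    exact ⟨hρ f ts ts' h' o, hρ f ts' ts (fun i o => (h' i o).symm) o⟩
  · have : Fintype O := Fintype.ofFinite O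
    rw [Nat.card_eq_fintype_card, Fintype.card_set, ← Nat.card_eq_fintype_card]
    exact Nat.pow_le_pow_right (by norm_num) hn
  · exact fun t t' h => hL t t' fun o => Set.ext_iff.1 h o

theorem Recognizable.univ : Recognizable ar 1 Set.univ :=
  ⟨fun _ => 0, fun _ _ _ _ => rfl, fun _ _ _ _ => trivial⟩

theorem Recognizable.inter {m n : ℕ} {L L' : Set (Tree ar)} (h : Recognizable ar m L)
    (h' : Recognizable ar n L') : Recognizable ar (m * n) (L ∩ L') := by
  obtain ⟨c, hc, hL⟩ := h
  obtain ⟨c', hc', hL'⟩ := h'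
  refine Recognizable.of_coloring (fun t => (c t, c' t)) ?_ (by simp) ?_
  · intro f ts ts' h
    exact Prod.ext (hc f ts ts' fun i => (Prod.ext_iff.1 (h i)).1)
      (hc' f ts ts' fun i => (Prod.ext_iff.1 (h i)).2)
  · rintro t t' h ⟨h1, h2⟩
    exact ⟨hL t t' (Prod.ext_iff.1 h).1 h1, hL' t t' (Prod.ext_iff.1 h).2 h2⟩

theorem Recognizable.forall_mem_list {ι : Type*} {g : ι → ℕ} {L : ι → Set (Tree ar)}
    (h : ∀ i, Recognizable ar (g i) (L i)) (l : List ι) :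
    Recognizable ar (l.map g).prod {t | ∀ i ∈ l, t ∈ L i} := by
  induction l with
  | nil => simpa using Recognizable.univ
  | cons i l ih =>
    rw [List.map_cons, List.prod_cons]
    convert (h i).inter ih using 1
    ext t
    simp

/-- Trees of depth less than `k`. -/
def Shallow : ℕ → Tree ar → Prop
  | 0, _ => False
  | _ + 1, Term.var _ => False
  | k + 1, Term.app _ ts => ∀ i, Shallow k (ts i)

theorem Shallow.succ {k : ℕ} {t : Tree ar} (h : Shallow k t) : Shallow (k + 1) t := by
  induction k generalizing t with
  | zero => exact h.elim
  | succ k ih =>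
    cases t with
    | var x => exact x.elim
    | app f ts => exact fun i => ih (h i)

theorem Shallow.mono {k l : ℕ} (hkl : k ≤ l) {t : Tree ar} (h : Shallow k t) : Shallow l t := by
  induction hkl with
  | refl => exact h
  | step _ ih => exact ih.succ

/-- A root with at most R subtrees of size at most (R + 1)^k gives 1 + R (R + 1)^k ≤ (R + 1)^(k +
1). -/
theorem Shallow.length_word_le {R : ℕ} (hR : ∀ f, ar f ≤ R) {k : ℕ} {t : Tree ar}
    (h : Shallow k t) : t.word.length ≤ (R + 1) ^ k := by
  induction k generalizing t with
  | zero => exact h.elim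
  | succ k ih =>
    cases t with
    | var x => exact x.elim
    | app f ts =>
      have hsum : ((List.ofFn fun i => (ts i).word).map List.length).sum ≤ R * (R + 1) ^ k := by
        rw [List.map_ofFn, List.sum_ofFn]
        calc ∑ i, (List.length ∘ fun i => (ts i).word) i ≤ ∑ _i : Fin (ar f), (R + 1) ^ k :=
              Finset.sum_le_sum fun i _ => ih (h i)
          _ = ar f * (R + 1) ^ k := by simp
          _ ≤ _ := Nat.mul_le_mul_right _ (hR f)
      have hpos : 1 ≤ (R + 1) ^ k := Nat.one_le_pow _ _ (by omega)
      rw [Term.word, List.length_cons, List.length_flatten, pow_succ]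
      nlinarith

/-- A nonempty recognizable language has an element of bounded size. -/
theorem Recognizable.exists_small {n R : ℕ} (hR : ∀ f, ar f ≤ R) {L : Set (Tree ar)}
    (h : Recognizable ar n L) (hne : L.Nonempty) : ∃ t ∈ L, t.word.length ≤ (R + 1) ^ n := by
  obtain ⟨c, hc, hL⟩ := h
  let C : ℕ → Set (Fin n) := fun k => c '' {t | Shallow k t}
  have hmono : Monotone C := fun k l hkl => Set.image_mono fun t ht => Shallow.mono hkl ht
  have hcard : ∀ k, (C k).ncard ≤ n := fun k => by
    simpa using Set.ncard_le_card (C k)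
  -- The colours of trees of depth less than k form an increasing chain of subsets of an n-element
  -- set, so the chain pauses at some k ≤ n.
  obtain ⟨k, hkn, hk⟩ := exists_eq_succ_of_le (f := fun k => (C k).ncard)
    (fun k l hkl => Set.ncard_le_ncard (hmono hkl) (Set.toFinite _)) hcard
  have hCk : C (k + 1) ⊆ C k :=
    (Set.eq_of_subset_of_ncard_le (hmono (Nat.le_succ k)) hk.ge (Set.toFinite _)).ge
  -- A pause is final: replacing the children by shallow trees of the same colours keeps the colour
  -- and gives depth less than k + 1, whose colours already occur in `C k`.
  have hall : ∀ t : Tree ar, c t ∈ C k := by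
    intro t
    induction t with
    | var x => exact x.elim
    | app f ts ih =>
      choose s hs hcs using ih
      rw [hc f ts s fun i => (hcs i).symm]
      exact hCk ⟨_, show Shallow (k + 1) (Term.app f s) from hs, rfl⟩
  obtain ⟨t, ht⟩ := hne
  obtain ⟨s, hs, hcs⟩ := hall t
  exact ⟨s, hL t s hcs.symm ht, (Shallow.mono hkn hs).length_word_le hR⟩

/-- The colours serve as states, with the transitions realized by actual trees and the colours of
elements of L as initial states. The only state with a run on a tree is then its colour. -/
theorem Recognizable.isRegularTreeLanguage [Finite Δ] {n : ℕ} {L : Set (Tree ar)}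
    (h : Recognizable ar n L) : IsRegularTreeLanguage ar L := by
  obtain ⟨c, hc, hL⟩ := h
  let T : Set (ℕ × Δ × List ℕ) :=
    {x | ∃ f ts, x = ((c (Term.app f ts)).1, f, List.ofFn fun i => (c (ts i)).1)}
  have hT : T.Finite := by
    refine (Set.finite_range fun y : Fin n × Σ f : Δ, Fin (ar f) → Fin n =>
      ((y.1.1, y.2.1, List.ofFn fun i => (y.2.2 i).1) : ℕ × Δ × List ℕ)).subset ?_
    rintro x ⟨f, ts, rfl⟩
    exact ⟨(c (Term.app f ts), ⟨f, fun i => c (ts i)⟩), rfl⟩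
  let I : Set ℕ := (fun t => (c t).1) '' L
  have hI : I.Finite := (Set.finite_lt_nat n).subset (by rintro _ ⟨t, -, rfl⟩; exact (c t).2)
  let A : TreeAutomaton Δ := ⟨hI.toFinset.toList, hT.toFinset.toList⟩
  have hrun : ∀ t q, A.Run ar q t ↔ q = (c t).1 := by
    intro t
    induction t with
    | var x => exact x.elim
    | app f ts ih =>
      intro q
      constructor
      · intro h
        cases h with
        | app qs _ htr hs =>
          have htr' : (q, f, List.ofFn qs) ∈ T := by simpa [A] using htr
          obtain ⟨f', ts', heq⟩ := htr'
          obtain ⟨rfl, h2⟩ := Prod.ext_iff.1 heq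
          obtain ⟨h3, h4⟩ := Prod.ext_iff.1 h2
          obtain rfl : f = f' := h3
          have h5 := List.ofFn_injective h4
          dsimp only
          rw [hc f ts' ts fun i => Fin.ext (((congrFun h5 i).symm).trans ((ih i _).1 (hs i)))]
      · rintro rfl
        refine TreeAutomaton.Run.app (fun i => (c (ts i)).1) ts ?_ fun i => (ih i _).2 rfl
        simp only [A, Finset.mem_toList, Set.Finite.mem_toFinset]
        exact ⟨f, ts, rfl⟩
  refine ⟨A, ?_⟩
  ext t
  constructor
  · rintro ⟨q, hq, hr⟩
    rw [hrun] at hr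
    subst hr
    obtain ⟨s, hs, hst⟩ : (c t).1 ∈ I := by simpa [A] using hq
    exact hL s t (Fin.ext hst) hs
  · intro ht
    refine ⟨(c t).1, ?_, (hrun t _).2 rfl⟩
    simp only [A, Finset.mem_toList, Set.Finite.mem_toFinset]
    exact ⟨t, ht, rfl⟩

end Recognizable

/-! ### Terms from Polish words, and subterms -/

namespace Term

variable {Δ X : Type*} {ar : Δ → ℕ}

open Classical in
/-- The term with a given Polish notation, if there is one. -/
noncomputable def ofWord (w : List (X ⊕ Δ)) : Option (Term ar X) :=
  if h : WellFormed ar w then some (equivWord.symm ⟨w, h⟩) else none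

theorem ofWord_eq_some {w : List (X ⊕ Δ)} {t : Term ar X} : ofWord w = some t ↔ t.word = w := by
  constructor
  · intro h
    rw [ofWord] at h
    split at h
    · rename_i hw
      simp only [Option.some.injEq] at h
      subst h
      exact congrArg Subtype.val (equivWord.apply_symm_apply ⟨w, hw⟩)
    · cases h
  · rintro rfl
    rw [ofWord, dif_pos (wellFormed_word t)]
    exact congrArg some (equivWord.symm_apply_apply t)

/-- The subterms of a term. -/
def subterms : Term ar X → List (Term ar X)
  | var x => [var x]
  | app f ts => app f ts :: (List.ofFn fun i => (ts i).subterms).flatten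

theorem mem_subterms_self (s : Term ar X) : s ∈ s.subterms := by
  cases s <;> simp [subterms]

theorem length_subterms (s : Term ar X) : s.subterms.length = s.word.length := by
  induction s with
  | var x => rfl
  | app f ts ih =>
    simp only [subterms, word, List.length_cons, List.length_flatten, List.map_ofFn]
    congr 3
    funext i
    exact ih i

theorem arg_mem_subterms {f : Δ} {ts : Fin (ar f) → Term ar X} {s : Term ar X}
    (h : app f ts ∈ s.subterms) (i : Fin (ar f)) : ts i ∈ s.subterms := by
  induction s with
  | var x => simp [subterms] at h
  | app g ss ih =>
    simp only [subterms, List.mem_cons, List.mem_flatten, List.mem_ofFn] at h ⊢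
    right
    rcases h with h | ⟨_, ⟨j, rfl⟩, h⟩
    · cases h
      exact ⟨_, ⟨i, rfl⟩, mem_subterms_self _⟩
    · exact ⟨_, ⟨j, rfl⟩, ih j h⟩

end Term

/-! ### Derivability -/

section Gen

variable {Δ N : Type*} {ar : Δ → ℕ}

/-- The tree `t` is derivable from the term `s`. -/
inductive Gen (P : List (N × Term ar N)) : Term ar N → Tree ar → Prop
  | var {A : N} {α : Term ar N} {t : Tree ar} (h : (A, α) ∈ P) (ht : Gen P α t) :
      Gen P (Term.var A) t
  | app {f : Δ} {ss : Fin (ar f) → Term ar N} {ts : Fin (ar f) → Tree ar}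
      (h : ∀ i, Gen P (ss i) (ts i)) : Gen P (Term.app f ss) (Term.app f ts)

variable {P : List (N × Term ar N)}

theorem gen_var_iff {A : N} {t : Tree ar} :
    Gen P (Term.var A) t ↔ ∃ α, (A, α) ∈ P ∧ Gen P α t :=
  ⟨fun h => by cases h with | var h ht => exact ⟨_, h, ht⟩, fun ⟨_, h, ht⟩ => .var h ht⟩

theorem gen_ofTree (t : Tree ar) : Gen P t.ofTree t := by
  induction t with
  | var x => exact x.elim
  | app f ts ih => exact .app ih

theorem Gen.of_step {s s' : Term ar N} (h : Grammar.Step P s s') :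
    ∀ {t : Tree ar}, Gen P s' t → Gen P s t := by
  induction h with
  | rule h => exact fun ht => .var h ht
  | arg ts i h ih =>
    intro t ht
    cases ht with
    | app ht =>
      refine .app fun j => ?_
      have := ht j
      by_cases hj : j = i
      · subst hj
        rw [Function.update_self] at this
        exact ih this
      · rwa [Function.update_of_ne hj] at this

/-- Derivations in different arguments do not interact, so they can be run one argument after
another; the induction is on the set of arguments already treated. -/
theorem reflTransGen_step_app {f : Δ} {ss ss' : Fin (ar f) → Term ar N}
    (h : ∀ i, Relation.ReflTransGen (Grammar.Step P) (ss i) (ss' i)) :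
    Relation.ReflTransGen (Grammar.Step P) (Term.app f ss) (Term.app f ss') := by
  have one : ∀ (ss : Fin (ar f) → Term ar N) (i : Fin (ar f)) (u v : Term ar N),
      Relation.ReflTransGen (Grammar.Step P) u v →
      Relation.ReflTransGen (Grammar.Step P) (Term.app f (Function.update ss i u))
        (Term.app f (Function.update ss i v)) := by
    intro ss i u v huv
    refine huv.lift (fun u => Term.app f (Function.update ss i u)) ?_
    intro a b hab
    have := Grammar.Step.arg (P := P) (Function.update ss i a) i (s := b)
      (by rwa [Function.update_self])
    rwa [Function.update_idem] at this
  have key : ∀ S : Finset (Fin (ar f)), Relation.ReflTransGen (Grammar.Step P) (Term.app f ss)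
      (Term.app f (S.piecewise ss' ss)) := by
    intro S
    induction S using Finset.induction_on with
    | empty => simpa using Relation.ReflTransGen.refl
    | insert i S hi ih =>
      refine ih.trans ?_
      have := one (S.piecewise ss' ss) i (ss i) (ss' i) (h i)
      rw [← Finset.piecewise_insert] at this
      convert this using 2
      rw [eq_comm, Function.update_eq_self_iff]
      simp [hi]
  simpa using key Finset.univ

theorem Gen.reflTransGen {s : Term ar N} {t : Tree ar} (h : Gen P s t) :
    Relation.ReflTransGen (Grammar.Step P) s t.ofTree := by
  induction h with
  | var h _ ih => exact .head (.rule h) ih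
  | app _ ih => exact reflTransGen_step_app ih

/-- Passing from rewriting sequences to derivation trees makes structural induction available. A
rewriting sequence is absorbed from its end: a tree derives itself, and `Gen` is stable under
prefixing a step. -/
theorem reflTransGen_step_iff {s : Term ar N} {t : Tree ar} :
    Relation.ReflTransGen (Grammar.Step P) s t.ofTree ↔ Gen P s t := by
  refine ⟨fun h => ?_, Gen.reflTransGen⟩
  induction h using Relation.ReflTransGen.head_induction_on with
  | refl => exact gen_ofTree t
  | head h _ ih => exact .of_step h ih

theorem Grammar.mem_language_iff {G : Grammar ar N} {t : Tree ar} :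
    t ∈ G.language ↔ Gen G.prods (Term.var G.start) t :=
  reflTransGen_step_iff

/-- The total size of the right-hand sides. -/
def prodsSize (P : List (N × Term ar N)) : ℕ := (P.map fun p => p.2.word.length).sum

/-- The subterms of right-hand sides are closed under taking arguments and under applying
productions. Which of them derive a tree therefore depends only on the root symbol and on which of
them derive the children. There are at most `prodsSize P` of them. Allowing several start symbols
covers the initial states of automata. -/
theorem recognizable_gen (P : List (N × Term ar N)) (I : List N) :
    Recognizable ar (2 ^ prodsSize P) {t | ∃ A ∈ I, Gen P (Term.var A) t} := by
  let l : List (Term ar N) := P.flatMap fun p => p.2.subterms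
  have hl : l.length = prodsSize P := by
    simp [l, prodsSize, List.length_flatMap, Term.length_subterms]
  have hmem : ∀ {A α}, (A, α) ∈ P → α ∈ l := fun h =>
    List.mem_flatMap.2 ⟨_, h, Term.mem_subterms_self _⟩
  classical
  refine Recognizable.of_properties (O := {s // s ∈ l.toFinset}) (fun s t => Gen P s t) ?_ ?_ ?_
  · rintro f ts ts' h ⟨s, hs⟩ hg
    rw [List.mem_toFinset] at hs
    -- Chain productions A → B leave the tree unchanged, so an induction on the derivation is needed
    -- to reach the root symbol.
    have key : ∀ {s t}, Gen P s t → s ∈ l → t = Term.app f ts → Gen P s (Term.app f ts') := by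
      intro s t hg
      induction hg with
      | var h _ ih => exact fun _ ht => .var h (ih (hmem h) ht)
      | app hg _ =>
        intro hs ht
        cases ht
        refine .app fun i => (h i ⟨_, List.mem_toFinset.2 ?_⟩).1 (hg i)
        obtain ⟨p, hp, hs⟩ := List.mem_flatMap.1 hs
        exact List.mem_flatMap.2 ⟨p, hp, Term.arg_mem_subterms hs i⟩
    exact key hg hs rfl
  · rw [← hl, Nat.card_eq_fintype_card, Fintype.card_coe]
    exact l.toFinset_card_le
  · rintro t t' h ⟨A, hA, hg⟩
    obtain ⟨α, hα, hg⟩ := gen_var_iff.1 hg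
    exact ⟨A, hA, .var hα ((h ⟨α, List.mem_toFinset.2 (hmem hα)⟩).1 hg)⟩

/-- A bound for the index of the language of a grammar. -/
def Grammar.index (G : Grammar ar N) : ℕ := 2 ^ prodsSize G.prods

theorem Grammar.recognizable_language (G : Grammar ar N) :
    Recognizable ar G.index G.language := by
  have h : G.language = {t | ∃ A ∈ [G.start], Gen G.prods (Term.var A) t} := by
    ext t
    simp [Grammar.mem_language_iff]
  rw [h]
  exact recognizable_gen G.prods [G.start]

/-! ### Tree automata as grammars -/

/-- The production of a transition. -/
noncomputable def transProd (ar : Δ → ℕ) (x : ℕ × Δ × List ℕ) : Option (ℕ × Term ar ℕ) :=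
  (Term.ofWord (Sum.inr x.2.1 :: x.2.2.map Sum.inl)).map (Prod.mk x.1)

/-- The transitions of an automaton as productions. -/
noncomputable def TreeAutomaton.prods (ar : Δ → ℕ) (A : TreeAutomaton Δ) : List (ℕ × Term ar ℕ) :=
  A.trans.filterMap (transProd ar)

theorem word_app_var {X : Type*} {f : Δ} (qs : Fin (ar f) → X) :
    (Term.app f fun i => Term.var (qs i) : Term ar X).word =
      Sum.inr f :: (List.ofFn qs).map Sum.inl := by
  rw [Term.word]
  congr 1
  have h : (List.ofFn fun i => (Term.var (qs i) : Term ar X).word) =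
      (List.ofFn qs).map fun x => [Sum.inl x] := by
    rw [List.map_ofFn]
    rfl
  rw [h, ← List.flatMap_def, List.map_eq_flatMap]

/-- Parsing puts the letters of l on the stack as variables, and f takes `ar f` of them; a single
term remains only if the stack is then exhausted. -/
theorem exists_of_word_eq {X : Type*} {f : Δ} {l : List X} {s : Term ar X}
    (h : s.word = Sum.inr f :: l.map Sum.inl) :
    ∃ qs : Fin (ar f) → X, l = List.ofFn qs ∧ s = Term.app f fun i => Term.var (qs i) := by
  have hp : ∀ l : List X, Term.parse (ar := ar) (l.map Sum.inl) = some (l.map Term.var) := by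
    intro l
    induction l with
    | nil => rfl
    | cons x l ih =>
      change Term.parseStep (Sum.inl x) (Term.parse (l.map Sum.inl)) = _
      rw [ih]
      rfl
  have h1 := Term.parse_word s
  rw [h] at h1
  change Term.parseStep (Sum.inr f) (Term.parse (l.map Sum.inl)) = _ at h1
  rw [hp] at h1
  simp only [Term.parseStep, Option.bind_some] at h1
  split at h1
  · rename_i hle
    simp only [Option.some.injEq, List.cons.injEq, List.drop_eq_nil_iff] at h1
    have hlen : l.length = ar f := le_antisymm (by simpa using h1.2) (by simpa using hle)
    refine ⟨fun i => l[i.1]'(by rw [hlen]; exact i.2), ?_, ?_⟩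
    · apply List.ext_getElem
      · simp [hlen]
      · intro i h1 h2
        simp
    · rw [← h1.1]
      simp
  · cases h1

/-- A transition with a state list of the wrong length does not spell a term, so it is dropped from
the productions, just as it is never applicable in a run. -/
theorem TreeAutomaton.mem_prods_iff {A : TreeAutomaton Δ} {q : ℕ} {α : Term ar ℕ} :
    (q, α) ∈ A.prods ar ↔ ∃ (f : Δ) (qs : Fin (ar f) → ℕ), (q, f, List.ofFn qs) ∈ A.trans ∧
      α = Term.app f fun i => Term.var (qs i) := by
  simp only [TreeAutomaton.prods, List.mem_filterMap, transProd, Option.map_eq_some_iff,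
    Term.ofWord_eq_some]
  constructor
  · rintro ⟨⟨q', f, l⟩, hx, s, hs, heq⟩
    cases heq
    obtain ⟨qs, hl, rfl⟩ := exists_of_word_eq hs
    exact ⟨f, qs, hl ▸ hx, rfl⟩
  · rintro ⟨f, qs, h, rfl⟩
    exact ⟨_, h, _, word_app_var qs, rfl⟩

theorem TreeAutomaton.run_iff_gen {A : TreeAutomaton Δ} {q : ℕ} {t : Tree ar} :
    A.Run ar q t ↔ Gen (A.prods ar) (Term.var q) t := by
  constructor
  · intro h
    induction h with
    | app qs ts h _ ih =>
      exact .var (TreeAutomaton.mem_prods_iff.2 ⟨_, qs, h, rfl⟩) (.app ih)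
  · induction t generalizing q with
    | var x => exact x.elim
    | app f ts ih =>
      intro h
      obtain ⟨α, hα, h⟩ := gen_var_iff.1 h
      obtain ⟨g, qs, htr, rfl⟩ := TreeAutomaton.mem_prods_iff.1 hα
      cases h with
      | app h => exact .app qs ts htr fun i => ih i (h i)

theorem TreeAutomaton.mem_language_iff {A : TreeAutomaton Δ} {t : Tree ar} :
    t ∈ A.language ar ↔ ∃ q ∈ A.initial, Gen (A.prods ar) (Term.var q) t := by
  simp only [TreeAutomaton.language, Set.mem_ofPred_eq, TreeAutomaton.run_iff_gen]

/-- A bound for the index of the language of an automaton. -/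
noncomputable def TreeAutomaton.index (ar : Δ → ℕ) (A : TreeAutomaton Δ) : ℕ :=
  2 ^ prodsSize (A.prods ar)

theorem TreeAutomaton.recognizable_language (A : TreeAutomaton Δ) :
    Recognizable ar (A.index ar) (A.language ar) := by
  have h : A.language ar = {t | ∃ q ∈ A.initial, Gen (A.prods ar) (Term.var q) t} :=
    Set.ext fun _ => TreeAutomaton.mem_language_iff
  rw [h]
  exact recognizable_gen _ _

end Gen

/-! ### Languages of grammar encodings -/

section EncodedGrammars

variable {Δ N : Type*} {ar : Δ → ℕ}

theorem Term.symbol_eq {X : Type*} {f g : Δ} {ts : Fin (ar f) → Term ar X}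
    {ss : Fin (ar g) → Term ar X} (h : Term.app f ts = Term.app g ss) : f = g := by
  cases h
  rfl

theorem Term.args_eq {X : Type*} {f : Δ} {ts ss : Fin (ar f) → Term ar X}
    (h : Term.app f ts = Term.app f ss) : ts = ss := by
  cases h
  rfl

theorem encTerm_injective : Function.Injective (encTerm : Term ar N → GrammarTree ar N) := by
  intro s
  induction s with
  | var A =>
    intro t h
    cases t with
    | var B => simp only [encTerm] at h; cases h; rfl
    | app g ts => simp only [encTerm] at h; cases h
  | app f ss ih =>
    intro t h
    cases t with
    | var B => simp only [encTerm] at h; cases h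
    | app g ts =>
      simp only [encTerm] at h
      obtain rfl : f = g := GrammarSymbol.base.inj (Term.symbol_eq h)
      exact congrArg _ (funext fun i => ih i (congrFun (Term.args_eq h) i))

theorem encProds_injective :
    Function.Injective (encProds : List (N × Term ar N) → GrammarTree ar N) := by
  intro P
  induction P with
  | nil =>
    intro Q h
    cases Q with
    | nil => rfl
    | cons q Q => simp only [encProds] at h; cases h
  | cons p P ih =>
    intro Q h
    cases Q with
    | nil => simp only [encProds] at h; cases h
    | cons q Q =>
      obtain ⟨A, α⟩ := p
      obtain ⟨B, β⟩ := q
      simp only [encProds] at h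
      obtain rfl : A = B := GrammarSymbol.lhs.inj (Term.symbol_eq h)
      have h := Term.args_eq h
      have h0 : encTerm α = encTerm β := congrFun h (0 : Fin 2)
      have h1 : encProds P = encProds Q := congrFun h (1 : Fin 2)
      rw [encTerm_injective h0, ih h1]

/-- Injectivity is what lets conditions on encodings, each stated with its own existential grammar,
be intersected: they all speak of the same grammar. -/
theorem Grammar.enc_injOn : Set.InjOn Grammar.enc {G : Grammar ar N | G.StartFirst} := by
  rintro ⟨S, P⟩ ⟨α, Q, h⟩ ⟨S', P'⟩ ⟨α', Q', h'⟩ he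
  obtain rfl : P = P' := encProds_injective (congrFun (Term.args_eq he) (0 : Fin 1))
  dsimp only at h h'
  rw [h, List.cons.injEq, Prod.mk.injEq] at h'
  rw [h'.1.1]

variable {K : Type*}

/-- The tree `t` is obtained from the term `s` by replacing each occurrence of a nonterminal `A` by a
tree of some colour `k` with `(A, k) ∈ W`. -/
inductive Subst (c : Tree ar → K) (W : Set (N × K)) : Term ar N → Tree ar → Prop
  | var {A : N} {t : Tree ar} (h : (A, c t) ∈ W) : Subst c W (Term.var A) t
  | app {f : Δ} {ss : Fin (ar f) → Term ar N} {ts : Fin (ar f) → Tree ar}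
      (h : ∀ i, Subst c W (ss i) (ts i)) : Subst c W (Term.app f ss) (Term.app f ts)

/-- The colour `k` is obtained from `W` by one of the productions for `A`. -/
def StepColor (c : Tree ar → K) (P : List (N × Term ar N)) (W : Set (N × K)) (A : N) (k : K) :
    Prop :=
  ∃ α e, (A, α) ∈ P ∧ Subst c W α e ∧ c e = k

/-- The colours of the trees that are derivable from the nonterminals. -/
def genColors (c : Tree ar → K) (P : List (N × Term ar N)) : Set (N × K) :=
  {x | ∃ e, Gen P (Term.var x.1) e ∧ c e = x.2}

theorem stepColor_append {c : Tree ar → K} {P Q : List (N × Term ar N)} {W : Set (N × K)} {A : N}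
    {k : K} : StepColor c (P ++ Q) W A k ↔ StepColor c P W A k ∨ StepColor c Q W A k := by
  simp only [StepColor, List.mem_append]
  grind

/-- The derivable colours are the least set closed under the one-step operator. Written as a
quantification over all closed W, this uses the productions only through `StepColor`, which looks at
one production at a time. -/
theorem mem_genColors_iff {c : Tree ar → K} (hc : IsCongruence c) {P : List (N × Term ar N)}
    {x : N × K} : x ∈ genColors c P ↔
      ∀ W : Set (N × K), (∀ A k, StepColor c P W A k → (A, k) ∈ W) → x ∈ W := by
  constructor
  · rintro ⟨e, he, hk⟩ W hW
    have key : ∀ {s t}, Gen P s t → Subst c W s t := by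
      intro s t h
      induction h with
      | var h _ ih => exact .var (hW _ _ ⟨_, _, h, ih, rfl⟩)
      | app _ ih => exact .app ih
    have := key he
    cases this with
    | var h => rwa [hk] at h
  · intro h
    refine h _ ?_
    rintro A k ⟨α, e, hα, hs, rfl⟩
    -- A substituted subtree need not itself be derivable; it is exchanged for a derivable one of
    -- the same colour, and the congruence preserves the colour of the whole.
    have key : ∀ {s t}, Subst c (genColors c P) s t → ∃ t', Gen P s t' ∧ c t' = c t := by
      intro s t h
      induction h with
      | var h => exact h
      | app _ ih =>
        choose ts' hg hc' using ih
        exact ⟨_, .app hg, hc _ _ _ hc'⟩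
    obtain ⟨e', he', hce⟩ := key hs
    exact ⟨e', .var hα he', hce⟩

/-- The names of the properties of a grammar tree on which membership in a language of encodings
depends. -/
abbrev EncProperty (N K : Type*) :=
  (Unit ⊕ Set (N × K) × K) ⊕ (Unit ⊕ N ⊕ Set (N × K) × N × K) ⊕ Unit

/-- The grammars that have property `R` of the colours derivable from the nonterminals with the help
of additional productions `P₀`. -/
def encLanguage (c : Tree ar → K) (P₀ : List (N × Term ar N)) (R : Set (N × K) → N → Prop) :
    Set (GrammarTree ar N) :=
  {t | ∃ G : Grammar ar N, G.StartFirst ∧ R (genColors c (G.prods ++ P₀)) G.start ∧ G.enc = t}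

/-- The properties of a grammar tree on which membership in a language of encodings depends. -/
def HasEncProperty (c : Tree ar → K) (P₀ : List (N × Term ar N)) (R : Set (N × K) → N → Prop) :
    EncProperty N K → GrammarTree ar N → Prop
  | Sum.inl (Sum.inl _), t => ∃ α : Term ar N, encTerm α = t
  | Sum.inl (Sum.inr (W, k)), t => ∃ (α : Term ar N) (e : Tree ar),
      encTerm α = t ∧ Subst c W α e ∧ c e = k
  | Sum.inr (Sum.inl (Sum.inl _)), t => ∃ P : List (N × Term ar N), encProds P = t
  | Sum.inr (Sum.inl (Sum.inr (Sum.inl A))), t =>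
      ∃ (α : Term ar N) (P : List (N × Term ar N)), encProds ((A, α) :: P) = t
  | Sum.inr (Sum.inl (Sum.inr (Sum.inr (W, A, k)))), t =>
      ∃ P : List (N × Term ar N), encProds P = t ∧ StepColor c P W A k
  | Sum.inr (Sum.inr _), t => t ∈ encLanguage c P₀ R

/-- Each property is decided by the root symbol and by the properties of the children. Properties of
being an encoding at all are included because both children of an `lhs` node must be valid. The
nonterminal of the first production is recorded so that the root can recover the start symbol. -/
theorem HasEncProperty.app {c : Tree ar → K} (hc : IsCongruence c) {P₀ : List (N × Term ar N)}
    {R : Set (N × K) → N → Prop} (f : GrammarSymbol Δ N)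
    (ts ts' : Fin (f.arity ar) → GrammarTree ar N)
    (h : ∀ i o, HasEncProperty c P₀ R o (ts i) ↔ HasEncProperty c P₀ R o (ts' i))
    (o : EncProperty N K) (ho : HasEncProperty c P₀ R o (Term.app f ts)) :
    HasEncProperty c P₀ R o (Term.app f ts') := by
  have hterm : ∀ i, (∃ α : Term ar N, encTerm α = ts i) → ∃ α : Term ar N, encTerm α = ts' i :=
    fun i => (h i (Sum.inl (Sum.inl ()))).1
  have hsubst : ∀ i W k, (∃ (α : Term ar N) (e : Tree ar),
      encTerm α = ts i ∧ Subst c W α e ∧ c e = k) → ∃ (α : Term ar N) (e : Tree ar),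
      encTerm α = ts' i ∧ Subst c W α e ∧ c e = k :=
    fun i W k => (h i (Sum.inl (Sum.inr (W, k)))).1
  have hprods : ∀ i, (∃ P : List (N × Term ar N), encProds P = ts i) →
      ∃ P : List (N × Term ar N), encProds P = ts' i :=
    fun i => (h i (Sum.inr (Sum.inl (Sum.inl ())))).1
  have hfirst : ∀ i A, (∃ (α : Term ar N) (P : List (N × Term ar N)),
      encProds ((A, α) :: P) = ts i) → ∃ (α : Term ar N) (P : List (N × Term ar N)),
      encProds ((A, α) :: P) = ts' i :=
    fun i A => (h i (Sum.inr (Sum.inl (Sum.inr (Sum.inl A))))).1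
  have hstep : ∀ i W A k, (∃ P : List (N × Term ar N), encProds P = ts i ∧ StepColor c P W A k) ↔
      ∃ P : List (N × Term ar N), encProds P = ts' i ∧ StepColor c P W A k :=
    fun i W A k => h i (Sum.inr (Sum.inl (Sum.inr (Sum.inr (W, A, k)))))
  clear h
  rcases o with (_ | ⟨W, k⟩) | (_ | A | ⟨W, A, k⟩) | _ <;>
    simp only [HasEncProperty] at ho ⊢
  · obtain ⟨α, hα⟩ := ho
    cases α with
    | var A =>
      simp only [encTerm] at hα
      cases hα
      exact ⟨Term.var A, congrArg _ (funext fun i => i.elim0)⟩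
    | app g αs =>
      simp only [encTerm] at hα
      cases hα
      choose βs hβ using fun i => hterm i ⟨_, rfl⟩
      exact ⟨Term.app g βs, congrArg _ (funext hβ)⟩
  · obtain ⟨α, e, hα, hs, rfl⟩ := ho
    cases α with
    | var A =>
      simp only [encTerm] at hα
      cases hα
      exact ⟨Term.var A, e, congrArg _ (funext fun i => i.elim0), hs, rfl⟩
    | app g αs =>
      simp only [encTerm] at hα
      cases hα
      cases hs with
      | app hs =>
        choose βs es hβ hs' hes using fun i => hsubst i W _ ⟨_, _, rfl, hs i, rfl⟩
        exact ⟨Term.app g βs, Term.app g es, congrArg _ (funext hβ), .app hs', hc _ _ _ hes⟩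
  · obtain ⟨P, hP⟩ := ho
    rcases P with _ | ⟨⟨A, α⟩, P⟩
    · simp only [encProds] at hP
      cases hP
      exact ⟨[], congrArg _ (funext fun i => i.elim0)⟩
    · simp only [encProds] at hP
      cases hP
      obtain ⟨β, hβ⟩ := hterm (0 : Fin 2) ⟨_, rfl⟩
      obtain ⟨Q, hQ⟩ := hprods (1 : Fin 2) ⟨_, rfl⟩
      exact ⟨(A, β) :: Q, congrArg _ (funext (Fin.forall_fin_two.2 ⟨hβ, hQ⟩))⟩
  · obtain ⟨α, P, hP⟩ := ho
    simp only [encProds] at hP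
    cases hP
    obtain ⟨β, hβ⟩ := hterm (0 : Fin 2) ⟨_, rfl⟩
    obtain ⟨Q, hQ⟩ := hprods (1 : Fin 2) ⟨_, rfl⟩
    exact ⟨β, Q, congrArg _ (funext (Fin.forall_fin_two.2 ⟨hβ, hQ⟩))⟩
  · obtain ⟨P, hP, α, e, hα, hs, rfl⟩ := ho
    rcases P with _ | ⟨⟨B, β⟩, P⟩
    · cases hα
    · simp only [encProds] at hP
      cases hP
      rcases List.mem_cons.1 hα with hα | hα
      · cases hα
        obtain ⟨β, e', hβ, hs', he'⟩ := hsubst (0 : Fin 2) W _ ⟨_, _, rfl, hs, rfl⟩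
        obtain ⟨Q, hQ⟩ := hprods (1 : Fin 2) ⟨_, rfl⟩
        exact ⟨(A, β) :: Q, congrArg _ (funext (Fin.forall_fin_two.2 ⟨hβ, hQ⟩)), β, e',
          List.mem_cons_self, hs', he'⟩
      · obtain ⟨β, hβ⟩ := hterm (0 : Fin 2) ⟨_, rfl⟩
        obtain ⟨Q, hQ, α', e', hα', hs', he'⟩ :=
          (hstep (1 : Fin 2) W A _).1 ⟨_, rfl, α, e, hα, hs, rfl⟩
        exact ⟨(B, β) :: Q, congrArg _ (funext (Fin.forall_fin_two.2 ⟨hβ, hQ⟩)), α', e',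
          List.mem_cons_of_mem _ hα', hs', he'⟩
  · obtain ⟨⟨S, P⟩, ⟨α, P', hP⟩, hR, he⟩ := ho
    dsimp only at hP hR
    subst hP
    simp only [Grammar.enc] at he
    cases he
    obtain ⟨β, Q, hQ⟩ := hfirst (0 : Fin 1) S ⟨α, P', rfl⟩
    refine ⟨⟨S, (S, β) :: Q⟩, ⟨β, Q, rfl⟩, ?_, congrArg _ (funext fun i => ?_)⟩
    · have hiff : ∀ W A k, StepColor c ((S, α) :: P') W A k ↔
          StepColor c ((S, β) :: Q) W A k := by
        intro W A k
        constructor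
        · intro h
          obtain ⟨P₁, hP₁, h₁⟩ := (hstep (0 : Fin 1) W A k).1 ⟨_, rfl, h⟩
          rwa [encProds_injective (hP₁.trans hQ.symm)] at h₁
        · intro h
          obtain ⟨P₁, hP₁, h₁⟩ := (hstep (0 : Fin 1) W A k).2 ⟨_, hQ, h⟩
          rwa [encProds_injective (hP₁.trans rfl : encProds P₁ = encProds ((S, α) :: P'))] at h₁
      have heq : genColors c (((S, β) :: Q) ++ P₀) = genColors c (((S, α) :: P') ++ P₀) := by
        ext x
        simp only [mem_genColors_iff hc, stepColor_append, hiff]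
      change R (genColors c (((S, β) :: Q) ++ P₀)) S
      rwa [heq]
    · obtain rfl : i = 0 := Subsingleton.elim (α := Fin 1) _ _
      exact hQ

/-- A bound for the index of a language of encodings, for `v` nonterminals and `n` colours. -/
def encIndex (v n : ℕ) : ℕ :=
  2 ^ (1 + 2 ^ (v * n) * n + (1 + (v + 2 ^ (v * n) * (v * n))) + 1)

/-- Membership in the language is itself one of the properties, so saturation under the congruence
is immediate. What remains is to count the property names, with 2^(v n) choices of W. -/
theorem recognizable_encLanguage [Finite N] {n : ℕ} {c : Tree ar → Fin n} (hc : IsCongruence c)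
    (P₀ : List (N × Term ar N)) (R : Set (N × Fin n) → N → Prop) :
    Recognizable (GrammarSymbol.arity ar) (encIndex (Nat.card N) n) (encLanguage c P₀ R) := by
  refine Recognizable.of_properties (HasEncProperty c P₀ R) (HasEncProperty.app hc) ?_
    fun t t' h => (h (Sum.inr (Sum.inr ()))).1
  have hset : Nat.card (Set (N × Fin n)) = 2 ^ (Nat.card N * n) := by
    have : Fintype N := Fintype.ofFinite N
    classical
    rw [Nat.card_eq_fintype_card, Fintype.card_set, Fintype.card_prod, Fintype.card_fin,
      Nat.card_eq_fintype_card]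
  simp [Nat.card_sum, Nat.card_prod, hset]
  omega

/-- The encodings of the grammars under the convention on the start nonterminal. -/
theorem recognizable_startFirst [Finite N] :
    Recognizable (GrammarSymbol.arity ar) (encIndex (Nat.card N) 1)
      {t : GrammarTree ar N | ∃ G : Grammar ar N, G.StartFirst ∧ G.enc = t} := by
  have h := recognizable_encLanguage (N := N) (ar := ar) (c := fun _ => (0 : Fin 1))
    (fun _ _ _ _ => rfl) [] fun _ _ => True
  simpa [encLanguage] using h

/-- The encodings of the grammars that, together with the productions `P₀`, derive an element of a
recognizable language. -/
theorem recognizable_derives [Finite N] {n : ℕ} {L : Set (Tree ar)} (hL : Recognizable ar n L)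
    (P₀ : List (N × Term ar N)) :
    Recognizable (GrammarSymbol.arity ar) (encIndex (Nat.card N) n)
      {t : GrammarTree ar N | ∃ G : Grammar ar N, G.StartFirst ∧
        (∃ e ∈ L, Gen (G.prods ++ P₀) (Term.var G.start) e) ∧ G.enc = t} := by
  obtain ⟨c, hc, hL⟩ := hL
  -- Since L is a union of colour classes, deriving an element of L means deriving some tree with
  -- the colour of an element of L.
  have h := recognizable_encLanguage hc P₀ fun Z S => ∃ e ∈ L, (S, c e) ∈ Z
  convert h using 1
  ext t
  simp only [encLanguage, genColors, Set.mem_ofPred_eq]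
  refine exists_congr fun G => and_congr_right fun _ => and_congr_left fun _ => ?_
  constructor
  · rintro ⟨e, he, hg⟩
    exact ⟨e, he, e, hg, rfl⟩
  · rintro ⟨e, he, e', hg, hce⟩
    exact ⟨e', hL e e' hce.symm he, hg⟩

end EncodedGrammars

/-! ### Primitive recursive enumeration and saturation -/

section PrimrecTools

variable {α β : Type*}

/-- The elements of a finite type. -/
noncomputable def elems (α : Type*) [Finite α] : List α := (Fintype.ofFinite α).elems.toList

theorem mem_elems [Finite α] (a : α) : a ∈ elems α := by
  rw [elems, Finset.mem_toList]
  exact (Fintype.ofFinite α).complete a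

/-- The lists of length `n` with entries from a list. -/
def tuples (l : List α) : ℕ → List (List α)
  | 0 => [[]]
  | n + 1 => l.flatMap fun a => (tuples l n).map (List.cons a)

theorem mem_tuples {l : List α} {n : ℕ} {L : List α} :
    L ∈ tuples l n ↔ L.length = n ∧ ∀ a ∈ L, a ∈ l := by
  induction n generalizing L with
  | zero => cases L <;> simp [tuples]
  | succ n ih => cases L <;> simp [tuples, ih]; tauto

/-- The lists of length at most `m` with entries from a list. -/
def listsUpTo (l : List α) (m : ℕ) : List (List α) := (List.range (m + 1)).flatMap (tuples l)

theorem mem_listsUpTo {l : List α} {m : ℕ} {L : List α} :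
    L ∈ listsUpTo l m ↔ L.length ≤ m ∧ ∀ a ∈ L, a ∈ l := by
  simp [listsUpTo, mem_tuples]

/-- A list that contains the contiguous sublists of a list. -/
def infixes (l : List α) : List (List α) :=
  (List.range (l.length + 1)).flatMap fun i =>
    (List.range (l.length + 1)).map fun j => (l.drop i).take j

theorem mem_infixes_of_isInfix {u l : List α} (h : u <:+: l) : u ∈ infixes l := by
  obtain ⟨a, b, rfl⟩ := h
  simp only [infixes, List.mem_flatMap, List.mem_map, List.mem_range, List.length_append]
  refine ⟨a.length, by omega, u.length, by omega, ?_⟩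
  simp

open Classical in
/-- Starting from the empty list, collect `n` times the candidates that are justified in one step. -/
noncomputable def saturate (cand : List β) (step : List β → β → Prop) : ℕ → List β
  | 0 => []
  | n + 1 => cand.filter fun x => step (saturate cand step n) x

/-- By monotonicity the rounds form an increasing chain of sublists of the candidates, so some round
within `cand.length` adds nothing, and all later rounds agree with it. Working with sublists makes
equal length imply equality even with repeated candidates. -/
theorem saturate_closed {cand : List β} {step : List β → β → Prop}
    (hmono : ∀ F F' x, F ⊆ F' → step F x → step F' x) {x : β} (hx : x ∈ cand)
    (hs : step (saturate cand step cand.length) x) : x ∈ saturate cand step cand.length := by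
  have hsub : ∀ k, (saturate cand step k).Sublist (saturate cand step (k + 1)) := by
    intro k
    induction k with
    | zero => exact List.nil_sublist _
    | succ k ih =>
      refine List.monotone_filter_right _ fun y hy => ?_
      simp only [decide_eq_true_eq] at hy ⊢
      exact hmono _ _ _ ih.subset hy
  have hlen : ∀ k, (saturate cand step k).length ≤ cand.length := by
    intro k
    cases k with
    | zero => simp [saturate]
    | succ k => exact List.length_filter_le _ _
  obtain ⟨k, hk, heq⟩ := exists_eq_succ_of_le
    (monotone_nat_of_le_succ fun k => (hsub k).length_le) hlen
  have hstable : ∀ j, k ≤ j → saturate cand step j = saturate cand step k := by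
    intro j hj
    induction hj with
    | refl => rfl
    | step _ ih =>
      rw [saturate, ih, ← saturate]
      exact ((hsub k).eq_of_length heq).symm
  rw [hstable _ hk] at hs
  rw [hstable _ hk, (hsub k).eq_of_length heq, saturate, List.mem_filter]
  exact ⟨hx, by simpa using hs⟩

theorem saturate_induction {cand : List β} {step : List β → β → Prop} {p : β → Prop}
    (h : ∀ F x, (∀ y ∈ F, p y) → step F x → p x) {n : ℕ} : ∀ x ∈ saturate cand step n, p x := by
  induction n with
  | zero => simp [saturate]
  | succ n ih =>
    intro x hx
    rw [saturate, List.mem_filter] at hx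
    exact h _ x ih (by simpa using hx.2)

/-! ### Closure properties of primitive recursive and computable functions -/

variable [Primcodable α] [Primcodable β]

theorem primrecPred_exists_mem {f : α → List β} {R : α → β → Prop} (hf : Primrec f)
    (hR : PrimrecPred fun x : α × β => R x.1 x.2) : PrimrecPred fun a => ∃ b ∈ f a, R a b :=
  (PrimrecRel.exists_mem_list (R := fun b a => R a b)
    (hR.comp (Primrec.pair Primrec.snd Primrec.fst))).comp hf Primrec.id

theorem primrecPred_forall_mem {f : α → List β} {R : α → β → Prop} (hf : Primrec f)
    (hR : PrimrecPred fun x : α × β => R x.1 x.2) : PrimrecPred fun a => ∀ b ∈ f a, R a b :=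
  (PrimrecRel.forall_mem_list (R := fun b a => R a b)
    (hR.comp (Primrec.pair Primrec.snd Primrec.fst))).comp hf Primrec.id

theorem primrecPred_mem {f : α → List β} {g : α → β} (hf : Primrec f) (hg : Primrec g) :
    PrimrecPred fun a => g a ∈ f a :=
  (primrecPred_exists_mem (R := fun a b => g a = b) hf
    (Primrec.eq.comp (hg.comp Primrec.fst) Primrec.snd)).of_eq fun a => by simp

theorem primrec_filter {f : α → List β} {R : α → β → Prop} [∀ a, DecidablePred (R a)]
    (hf : Primrec f) (hR : PrimrecPred fun x : α × β => R x.1 x.2) :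
    Primrec fun a => (f a).filter fun b => R a b :=
  (PrimrecRel.listFilter (R := fun b a => R a b)
    (hR.comp (Primrec.pair Primrec.snd Primrec.fst))).comp hf Primrec.id

theorem primrec_pow : Primrec₂ ((· ^ ·) : ℕ → ℕ → ℕ) :=
  Primrec₂.unpaired'.1 Nat.Primrec.pow

theorem primrec_sum : Primrec (List.sum : List ℕ → ℕ) :=
  Primrec.list_foldr Primrec.id (Primrec.const 0)
    (Primrec.nat_add.comp (Primrec.fst.comp Primrec.snd) (Primrec.snd.comp Primrec.snd)).to₂

theorem primrec_prod : Primrec (List.prod : List ℕ → ℕ) :=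
  Primrec.list_foldr Primrec.id (Primrec.const 1)
    (Primrec.nat_mul.comp (Primrec.fst.comp Primrec.snd) (Primrec.snd.comp Primrec.snd)).to₂

theorem primrec_tuples : Primrec₂ (tuples : List α → ℕ → List (List α)) := by
  have hstep : Primrec₂ fun (l : List α) (x : ℕ × List (List α)) =>
      l.flatMap fun a => x.2.map (List.cons a) :=
    Primrec.list_flatMap Primrec.fst (Primrec.list_map
      (Primrec.snd.comp (Primrec.snd.comp Primrec.fst))
      (Primrec.list_cons.comp (Primrec.snd.comp Primrec.fst) Primrec.snd).to₂).to₂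
  refine (Primrec.nat_rec (Primrec.const [[]]) hstep).of_eq fun l n => ?_
  induction n with
  | zero => rfl
  | succ n ih => rw [tuples, ← ih]

theorem primrec_listsUpTo : Primrec₂ (listsUpTo : List α → ℕ → List (List α)) :=
  Primrec.list_flatMap (Primrec.list_range.comp (Primrec.succ.comp Primrec.snd))
    (primrec_tuples.comp (Primrec.fst.comp Primrec.fst) Primrec.snd).to₂

theorem primrec_infixes : Primrec (infixes : List α → List (List α)) := by
  have hrange : Primrec fun l : List α => List.range (l.length + 1) :=
    Primrec.list_range.comp (Primrec.succ.comp Primrec.list_length)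
  exact Primrec.list_flatMap hrange (Primrec.list_map (hrange.comp Primrec.fst)
    (Primrec.list_take.comp Primrec.snd (Primrec.list_drop.comp (Primrec.snd.comp Primrec.fst)
      (Primrec.fst.comp Primrec.fst))).to₂).to₂

theorem primrec_saturate {cand : α → List β} {step : α → List β → β → Prop} {n : α → ℕ}
    (hc : Primrec cand) (hs : PrimrecPred fun x : (α × List β) × β => step x.1.1 x.1.2 x.2)
    (hn : Primrec n) : Primrec fun a => saturate (cand a) (step a) (n a) := by
  classical
  have hstep : Primrec₂ fun (a : α) (x : ℕ × List β) =>
      (cand a).filter fun y => step a x.2 y :=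
    primrec_filter (α := α × ℕ × List β) (R := fun z y => step z.1 z.2.2 y)
      (hc.comp Primrec.fst) (hs.comp (Primrec.pair (Primrec.pair (Primrec.fst.comp Primrec.fst)
        (Primrec.snd.comp (Primrec.snd.comp Primrec.fst))) Primrec.snd))
  refine (Primrec.nat_rec' hn (Primrec.const []) hstep).of_eq fun a => ?_
  induction n a with
  | zero => rfl
  | succ n ih =>
    rw [saturate]
    simp only [← ih]

/-- Recursion on the length of the prefix already treated, appending one image per round. It is
needed for the passage from examples to automata, which is only assumed computable. -/
theorem computable_list_map {f : α → β} (hf : Computable f) : Computable (List.map f) := by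
  have hstep : Computable₂ fun (l : List α) (x : ℕ × List β) =>
      x.2 ++ (l[x.1]?.map f).toList :=
    Computable.list_append.comp (Computable.snd.comp Computable.snd)
      (Primrec.optionToList.to_comp.comp (Computable.option_map
        (Computable.list_getElem?.comp Computable.fst (Computable.fst.comp Computable.snd))
        (hf.comp Computable.snd).to₂))
  refine (Computable.nat_rec Computable.list_length (Computable.const []) hstep).of_eq fun l => ?_
  have key : ∀ n, (Nat.rec [] (fun n IH => IH ++ (l[n]?.map f).toList) n : List β) =
      (l.take n).map f := by
    intro n
    induction n with
    | zero => rfl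
    | succ n ih =>
      change _ ++ _ = _
      rw [ih, List.take_add_one, List.map_append]
      cases l[n]? <;> rfl
  exact (key l.length).trans (by rw [List.take_length])

end PrimrecTools

/-! ### Derivability is primitive recursive -/

section PrimrecGen

variable {Δ N : Type*} {ar : Δ → ℕ}

theorem Term.word_arg_isInfix {X : Type*} {f : Δ} (ts : Fin (ar f) → Term ar X)
    (i : Fin (ar f)) : (ts i).word <:+: (Term.app f ts).word := by
  have h : (ts i).word ∈ List.ofFn fun i => (ts i).word := List.mem_ofFn.2 ⟨i, rfl⟩
  exact (List.infix_of_mem_flatten h).trans (List.suffix_cons _ _).isInfix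

theorem Term.word_app_of_getElem {X : Type*} {f : Δ} {l : List (List (X ⊕ Δ))}
    (hl : l.length = ar f) {ts : Fin (ar f) → Term ar X}
    (h : ∀ i : Fin (ar f), l[i.1]'(by rw [hl]; exact i.2) = (ts i).word) :
    (Term.app f ts).word = Sum.inr f :: l.flatten := by
  rw [Term.word]
  congr 2
  apply List.ext_getElem
  · simp [hl]
  · intro i h1 h2
    simp only [List.getElem_ofFn]
    exact (h ⟨i, by simpa using h1⟩).symm

/-- The Polish notations of a term and of a tree derivable from it. -/
abbrev GenFact (Δ N : Type*) := List (N ⊕ Δ) × List (Empty ⊕ Δ)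

/-- One step of the derivation of facts. -/
def GenStep [Finite Δ] (P : List (N × Term ar N)) (F : List (GenFact Δ N)) (x : GenFact Δ N) :
    Prop :=
  (∃ p ∈ P, x.1 = [Sum.inl p.1] ∧ (p.2.word, x.2) ∈ F) ∨
  ∃ f ∈ elems Δ, ∃ L ∈ tuples F (ar f), x.1 = Sum.inr f :: (L.map Prod.fst).flatten ∧
    x.2 = Sum.inr f :: (L.map Prod.snd).flatten

/-- The facts that are relevant for the derivation of a word. -/
def genCandidates (P : List (N × Term ar N)) (w : List (Empty ⊕ Δ)) : List (GenFact Δ N) :=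
  (P.flatMap fun p => infixes p.2.word).flatMap fun u => (infixes w).map (Prod.mk u)

/-- The facts that are derivable among the relevant ones. -/
noncomputable def genFacts [Finite Δ] (P : List (N × Term ar N)) (w : List (Empty ⊕ Δ)) :
    List (GenFact Δ N) :=
  saturate (genCandidates P w) (GenStep P) (genCandidates P w).length

/-- Soundness of the saturation: every recorded pair of words spells a genuine derivability
statement. -/
theorem exists_gen_of_mem_genFacts [Finite Δ] {P : List (N × Term ar N)} {w : List (Empty ⊕ Δ)} :
    ∀ x ∈ genFacts P w, ∃ s t, x = (s.word, t.word) ∧ Gen P s t := by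
  refine saturate_induction fun F x hF hx => ?_
  obtain ⟨u, v⟩ := x
  rcases hx with ⟨⟨A, α⟩, hp, hu, hv⟩ | ⟨f, -, L, hL, hu, hv⟩
  · obtain ⟨s, t, heq, hg⟩ := hF _ hv
    obtain ⟨h1, h2⟩ := Prod.ext_iff.1 heq
    dsimp only at h1 h2 hu
    obtain rfl := Term.word_injective h1
    exact ⟨Term.var A, t, Prod.ext hu h2, .var hp hg⟩
  · obtain ⟨hlen, hmem⟩ := mem_tuples.1 hL
    have hlt : ∀ i : Fin (ar f), i.1 < L.length := fun i => by rw [hlen]; exact i.2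
    choose ss ts heq hg using fun i : Fin (ar f) => hF _ (hmem _ (L.getElem_mem (hlt i)))
    refine ⟨Term.app f ss, Term.app f ts, Prod.ext ?_ ?_, .app hg⟩
    · exact hu.trans (Term.word_app_of_getElem (by simpa using hlen) fun i => by
        simp [heq]).symm
    · exact hv.trans (Term.word_app_of_getElem (by simpa using hlen) fun i => by
        simp [heq]).symm

theorem GenStep.mono [Finite Δ] {P : List (N × Term ar N)} (F F' : List (GenFact Δ N))
    (x : GenFact Δ N) (h : F ⊆ F') (hx : GenStep P F x) : GenStep P F' x := by
  rcases hx with ⟨p, hp, hu, hv⟩ | ⟨f, hf, L, hL, hx⟩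
  · exact .inl ⟨p, hp, hu, h hv⟩
  · rw [mem_tuples] at hL
    exact .inr ⟨f, hf, L, mem_tuples.2 ⟨hL.1, fun a ha => h (hL.2 a ha)⟩, hx⟩

/-- Completeness: a derivation passes only through subterms of right-hand sides and subtrees of the
target. Their Polish words are infixes of the given words, hence among the candidates. -/
theorem Gen.mem_genFacts [Finite Δ] {P : List (N × Term ar N)} {w : List (Empty ⊕ Δ)}
    {s : Term ar N} {t : Tree ar} (h : Gen P s t)
    (hs : ∃ p ∈ P, s.word <:+: p.2.word) (ht : t.word <:+: w) :
    (s.word, t.word) ∈ genFacts P w := by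
  induction h with
  | var h _ ih =>
    refine saturate_closed GenStep.mono ?_ (.inl ⟨_, h, rfl, ih ⟨_, h, List.infix_rfl⟩ ht⟩)
    obtain ⟨p, hp, hs⟩ := hs
    exact List.mem_flatMap.2 ⟨_, List.mem_flatMap.2 ⟨p, hp, mem_infixes_of_isInfix hs⟩,
      List.mem_map.2 ⟨_, mem_infixes_of_isInfix ht, rfl⟩⟩
  | @app f ss ts _ ih =>
    obtain ⟨p, hp, hs⟩ := hs
    refine saturate_closed GenStep.mono ?_ (.inr ⟨f, mem_elems f,
      List.ofFn fun i => ((ss i).word, (ts i).word), mem_tuples.2 ⟨by simp, ?_⟩, ?_, ?_⟩)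
    · exact List.mem_flatMap.2 ⟨_, List.mem_flatMap.2 ⟨p, hp, mem_infixes_of_isInfix hs⟩,
        List.mem_map.2 ⟨_, mem_infixes_of_isInfix ht, rfl⟩⟩
    · intro a ha
      obtain ⟨i, rfl⟩ := List.mem_ofFn.1 ha
      exact ih i ⟨p, hp, (Term.word_arg_isInfix ss i).trans hs⟩
        ((Term.word_arg_isInfix ts i).trans ht)
    · rw [List.map_ofFn, Term.word]
      rfl
    · rw [List.map_ofFn, Term.word]
      rfl

/-- The first production is split off because A may occur in no right-hand side and so may not be a
candidate itself. -/
theorem gen_var_iff_mem_genFacts [Finite Δ] {P : List (N × Term ar N)} {A : N} {t : Tree ar} :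
    Gen P (Term.var A) t ↔ ∃ p ∈ P, p.1 = A ∧ (p.2.word, t.word) ∈ genFacts P t.word := by
  rw [gen_var_iff]
  constructor
  · rintro ⟨α, hα, h⟩
    exact ⟨_, hα, rfl, h.mem_genFacts ⟨_, hα, List.infix_rfl⟩ List.infix_rfl⟩
  · rintro ⟨⟨_, α⟩, hp, rfl, h⟩
    obtain ⟨s, t', heq, hg⟩ := exists_gen_of_mem_genFacts _ h
    obtain ⟨h1, h2⟩ := Prod.ext_iff.1 heq
    obtain rfl := Term.word_injective h1
    obtain rfl := Term.word_injective h2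
    exact ⟨_, hp, hg⟩

/-- The terms of size at most `m`. -/
noncomputable def termsUpTo [Finite Δ] (ar : Δ → ℕ) (X : Type*) [Finite X] (m : ℕ) : List (Term ar X) :=
  (listsUpTo (elems (X ⊕ Δ)) m).filterMap Term.ofWord

theorem mem_termsUpTo [Finite Δ] {X : Type*} [Finite X] {m : ℕ} {s : Term ar X} :
    s ∈ termsUpTo ar X m ↔ s.word.length ≤ m := by
  simp only [termsUpTo, List.mem_filterMap, Term.ofWord_eq_some, mem_listsUpTo]
  constructor
  · rintro ⟨w, ⟨hw, -⟩, rfl⟩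
    exact hw
  · exact fun h => ⟨_, ⟨h, fun a _ => mem_elems a⟩, rfl⟩

theorem primrec_initial [Primcodable Δ] : Primrec (TreeAutomaton.initial : TreeAutomaton Δ → List ℕ) :=
  Primrec.fst.comp (Primrec.of_equiv (e := TreeAutomaton.equivProd (Δ := Δ)))

theorem primrec_trans [Primcodable Δ] : Primrec (TreeAutomaton.trans : TreeAutomaton Δ → List (ℕ × Δ × List ℕ)) :=
  Primrec.snd.comp (Primrec.of_equiv (e := TreeAutomaton.equivProd (Δ := Δ)))

variable [Finite Δ] [Primcodable Δ] [Primcodable N]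

/-- A term and its Polish word have the same code, because the coding of terms is transported along
`equivWord`. -/
theorem primrec_word : Primrec (Term.word : Term ar N → List (N ⊕ Δ)) :=
  Primrec.encode_iff.1 Primrec.encode

theorem primrec_ofWord : Primrec (Term.ofWord : List (N ⊕ Δ) → Option (Term ar N)) := by
  refine (Primrec.decode₂.comp Primrec.encode).of_eq fun w => Option.ext fun t => ?_
  rw [Term.ofWord_eq_some, ← Option.mem_def, Encodable.mem_decode₂]
  exact Encodable.encode_inj (a := t.word) (b := w)

theorem primrec_genCandidates : Primrec₂ (genCandidates :
    List (N × Term ar N) → List (Empty ⊕ Δ) → List (GenFact Δ N)) :=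
  Primrec.list_flatMap
    (Primrec.list_flatMap Primrec.fst (primrec_infixes.comp
      (primrec_word.comp (Primrec.snd.comp Primrec.snd))).to₂)
    (Primrec.list_map (primrec_infixes.comp (Primrec.snd.comp Primrec.fst))
      (Primrec.pair (Primrec.snd.comp Primrec.fst) Primrec.snd).to₂).to₂

theorem primrecPred_genStep : PrimrecPred
    fun x : (List (N × Term ar N) × List (GenFact Δ N)) × GenFact Δ N =>
      GenStep x.1.1 x.1.2 x.2 := by
  refine PrimrecPred.or ?_ ?_
  · refine primrecPred_exists_mem (Primrec.fst.comp Primrec.fst) (PrimrecPred.and ?_ ?_)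
    · exact Primrec.eq.comp (Primrec.fst.comp (Primrec.snd.comp Primrec.fst))
        (Primrec.list_cons.comp (Primrec.sumInl.comp (Primrec.fst.comp Primrec.snd))
          (Primrec.const []))
    · exact primrecPred_mem (Primrec.snd.comp (Primrec.fst.comp Primrec.fst))
        (Primrec.pair (primrec_word.comp (Primrec.snd.comp Primrec.snd))
          (Primrec.snd.comp (Primrec.snd.comp Primrec.fst)))
  · refine primrecPred_exists_mem (Primrec.const _) (primrecPred_exists_mem
      (primrec_tuples.comp (Primrec.snd.comp (Primrec.fst.comp Primrec.fst))
        ((Primrec.dom_finite ar).comp Primrec.snd)) (PrimrecPred.and ?_ ?_))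
    · exact Primrec.eq.comp
        (Primrec.fst.comp (Primrec.snd.comp (Primrec.fst.comp Primrec.fst)))
        (Primrec.list_cons.comp (Primrec.sumInr.comp (Primrec.snd.comp Primrec.fst))
          (Primrec.list_flatten.comp (Primrec.list_map Primrec.snd
            (Primrec.fst.comp Primrec.snd).to₂)))
    · exact Primrec.eq.comp
        (Primrec.snd.comp (Primrec.snd.comp (Primrec.fst.comp Primrec.fst)))
        (Primrec.list_cons.comp (Primrec.sumInr.comp (Primrec.snd.comp Primrec.fst))
          (Primrec.list_flatten.comp (Primrec.list_map Primrec.snd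
            (Primrec.snd.comp Primrec.snd).to₂)))

theorem primrec_genFacts : Primrec₂ (genFacts :
    List (N × Term ar N) → List (Empty ⊕ Δ) → List (GenFact Δ N)) :=
  primrec_saturate (α := List (N × Term ar N) × List (Empty ⊕ Δ))
    (step := fun a => GenStep a.1) primrec_genCandidates
    (primrecPred_genStep.comp (Primrec.pair (Primrec.pair (Primrec.fst.comp
      (Primrec.fst.comp Primrec.fst)) (Primrec.snd.comp Primrec.fst)) Primrec.snd))
    (Primrec.list_length.comp primrec_genCandidates)

theorem primrecPred_gen {α : Type*} [Primcodable α] {P : α → List (N × Term ar N)} {A : α → N}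
    {t : α → Tree ar} (hP : Primrec P) (hA : Primrec A) (ht : Primrec t) :
    PrimrecPred fun a => Gen (P a) (Term.var (A a)) (t a) := by
  have hw : Primrec fun a => (t a).word := primrec_word.comp ht
  refine (primrecPred_exists_mem (R := fun a p => p.1 = A a ∧
    (p.2.word, (t a).word) ∈ genFacts (P a) (t a).word) hP (PrimrecPred.and ?_ ?_)).of_eq
    fun a => gen_var_iff_mem_genFacts.symm
  · exact Primrec.eq.comp (Primrec.fst.comp Primrec.snd) (hA.comp Primrec.fst)
  · exact primrecPred_mem
      ((primrec_genFacts.comp hP hw).comp Primrec.fst)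
      (Primrec.pair (primrec_word.comp (Primrec.snd.comp Primrec.snd)) (hw.comp Primrec.fst))

theorem primrec_start : Primrec (Grammar.start : Grammar ar N → N) :=
  Primrec.fst.comp (Primrec.of_equiv (e := Grammar.equivProd (ar := ar) (N := N)))

theorem primrec_prods : Primrec (Grammar.prods : Grammar ar N → List (N × Term ar N)) :=
  Primrec.snd.comp (Primrec.of_equiv (e := Grammar.equivProd (ar := ar) (N := N)))

theorem primrec_grammar_mk : Primrec₂ (Grammar.mk : N → List (N × Term ar N) → Grammar ar N) :=
  Primrec.of_equiv_symm (e := Grammar.equivProd (ar := ar) (N := N))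

theorem primrec_automaton_prods :
    Primrec (TreeAutomaton.prods ar : TreeAutomaton Δ → List (ℕ × Term ar ℕ)) := by
  have h : Primrec (transProd ar) := by
    refine Primrec.option_map (primrec_ofWord.comp (Primrec.list_cons.comp ?_ ?_)) ?_
    · exact Primrec.sumInr.comp (Primrec.fst.comp Primrec.snd)
    · exact Primrec.list_map (Primrec.snd.comp Primrec.snd) (Primrec.sumInl.comp Primrec.snd).to₂
    · exact (Primrec.pair (Primrec.fst.comp Primrec.fst) Primrec.snd).to₂
  exact Primrec.listFilterMap primrec_trans (h.comp Primrec.snd).to₂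

theorem primrecPred_mem_grammar {α : Type*} [Primcodable α] {G : α → Grammar ar N}
    {t : α → Tree ar} (hG : Primrec G) (ht : Primrec t) :
    PrimrecPred fun a => t a ∈ (G a).language :=
  (primrecPred_gen (primrec_prods.comp hG) (primrec_start.comp hG) ht).of_eq
    fun _ => Grammar.mem_language_iff.symm

theorem primrecPred_mem_automaton {α : Type*} [Primcodable α] {A : α → TreeAutomaton Δ}
    {t : α → Tree ar} (hA : Primrec A) (ht : Primrec t) :
    PrimrecPred fun a => t a ∈ (A a).language ar := by
  refine (primrecPred_exists_mem (primrec_initial.comp hA) (primrecPred_gen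
    ((primrec_automaton_prods.comp hA).comp Primrec.fst) Primrec.snd (ht.comp Primrec.fst))).of_eq
    fun _ => TreeAutomaton.mem_language_iff.symm

theorem primrec_prodsSize : Primrec (prodsSize : List (N × Term ar N) → ℕ) :=
  primrec_sum.comp (Primrec.list_map Primrec.id
    (Primrec.list_length.comp (primrec_word.comp (Primrec.snd.comp Primrec.snd))).to₂)

theorem primrec_grammar_index : Primrec (Grammar.index : Grammar ar N → ℕ) :=
  primrec_pow.comp (Primrec.const 2) (primrec_prodsSize.comp primrec_prods)

theorem primrec_automaton_index : Primrec (TreeAutomaton.index ar : TreeAutomaton Δ → ℕ) :=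
  primrec_pow.comp (Primrec.const 2) (primrec_prodsSize.comp primrec_automaton_prods)

theorem primrec_termsUpTo {X : Type*} [Finite X] [Primcodable X] : Primrec (termsUpTo ar X) :=
  Primrec.listFilterMap (primrec_listsUpTo.comp (Primrec.const _) Primrec.id)
    (primrec_ofWord.comp Primrec.snd).to₂

end PrimrecGen

/-! ### The synthesis problem for instances given by automata -/

section Arity

variable {Δ : Type*} [Finite Δ]

/-- A bound for the arities of a finite ranked alphabet. -/
noncomputable def arityBound (ar : Δ → ℕ) : ℕ := ((elems Δ).map ar).sum

theorem le_arityBound (ar : Δ → ℕ) (f : Δ) : ar f ≤ arityBound ar :=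
  List.single_le_sum (by simp) _ (List.mem_map.2 ⟨f, mem_elems f, rfl⟩)

end Arity

/-! ### Polish words of encodings and enumeration of grammars -/

section Enc

variable {Δ N : Type*} {ar : Δ → ℕ}

/-- The effect of the encoding of right-hand sides on a symbol. -/
def encSymbol : N ⊕ Δ → Empty ⊕ GrammarSymbol Δ N
  | Sum.inl A => Sum.inr (GrammarSymbol.rhs A)
  | Sum.inr f => Sum.inr (GrammarSymbol.base f)

theorem word_encTerm (α : Term ar N) : (encTerm α).word = α.word.map encSymbol := by
  induction α with
  | var A => rfl
  | app f ts ih =>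
    simp only [encTerm, Term.word, List.map_cons, List.map_flatten, List.map_ofFn]
    exact congrArg (fun l => _ :: List.flatten (List.ofFn l)) (funext ih)

theorem word_encProds (P : List (N × Term ar N)) : (encProds P).word =
    (P.flatMap fun p => Sum.inr (GrammarSymbol.lhs p.1) :: p.2.word.map encSymbol) ++
      [Sum.inr GrammarSymbol.endSym] := by
  induction P with
  | nil => rfl
  | cons p P ih =>
    obtain ⟨A, α⟩ := p
    change Sum.inr _ :: (List.ofFn fun i : Fin 2 => (![encTerm α, encProds P] i).word).flatten = _
    simp [List.ofFn_succ, word_encTerm, ih]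

theorem word_enc (G : Grammar ar N) :
    G.enc.word = Sum.inr GrammarSymbol.rootSym :: (encProds G.prods).word := by
  change Sum.inr _ :: (List.ofFn fun i : Fin 1 => (![encProds G.prods] i).word).flatten = _
  simp [List.ofFn_succ]

theorem startFirst_iff {G : Grammar ar N} :
    G.StartFirst ↔ G.prods.head?.map Prod.fst = some G.start := by
  obtain ⟨S, P⟩ := G
  rcases P with _ | ⟨⟨A, α⟩, P⟩ <;> simp [Grammar.StartFirst]

theorem primrecPred_startFirst [Finite Δ] [Primcodable Δ] [Primcodable N] :
    PrimrecPred (Grammar.StartFirst : Grammar ar N → Prop) :=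
  (Primrec.eq.comp (Primrec.option_map (Primrec.list_head?.comp primrec_prods)
    (Primrec.fst.comp Primrec.snd).to₂) (Primrec.option_some.comp primrec_start)).of_eq
    fun _ => startFirst_iff.symm

section

variable [Finite Δ] [Finite N]

/-- The grammars with at most `m` productions, all of size at most `m`. -/
noncomputable def grammarsUpTo (ar : Δ → ℕ) (N : Type*) [Finite N] (m : ℕ) :
    List (Grammar ar N) :=
  (elems N).flatMap fun S =>
    (listsUpTo ((elems N).flatMap fun A => (termsUpTo ar N m).map (Prod.mk A)) m).map
      (Grammar.mk S)

/-- Each production contributes one `lhs` letter and its right-hand side to the encoding, so the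
size of the encoding bounds both the number of productions and the size of each. -/
theorem mem_grammarsUpTo {m : ℕ} {G : Grammar ar N} (h : G.enc.word.length ≤ m) :
    G ∈ grammarsUpTo ar N m := by
  have hsum : (G.prods.map fun p => p.2.word.length + 1).sum ≤ m := by
    rw [word_enc, word_encProds] at h
    simp only [List.length_cons, List.length_append, List.length_flatMap, List.length_map] at h
    omega
  refine List.mem_flatMap.2 ⟨G.start, mem_elems _, List.mem_map.2 ⟨G.prods, ?_, rfl⟩⟩
  refine mem_listsUpTo.2 ⟨?_, fun p hp => List.mem_flatMap.2 ⟨p.1, mem_elems _,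
    List.mem_map.2 ⟨p.2, mem_termsUpTo.2 ?_, rfl⟩⟩⟩
  · refine le_trans ?_ hsum
    rw [List.sum_map_add]
    simp
  · have := List.single_le_sum (by simp) _
      (List.mem_map_of_mem (f := fun p : N × Term ar N => p.2.word.length + 1) hp)
    omega

variable [Primcodable Δ] [Primcodable N]

/-- On Polish words, the structurally recursive encoding becomes letterwise relabelling and
concatenation. -/
theorem primrec_enc : Primrec (Grammar.enc : Grammar ar N → GrammarTree ar N) := by
  have h : Primrec fun G : Grammar ar N => G.enc.word := by
    have hsym : Primrec (encSymbol : N ⊕ Δ → _) := Primrec.dom_finite _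
    have hlhs : Primrec (GrammarSymbol.lhs : N → GrammarSymbol Δ N) := Primrec.dom_finite _
    simp only [word_enc, word_encProds]
    exact Primrec.list_cons.comp (Primrec.const _) (Primrec.list_append.comp
      (Primrec.list_flatMap primrec_prods (Primrec.list_cons.comp
        (Primrec.sumInr.comp (hlhs.comp (Primrec.fst.comp Primrec.snd)))
        (Primrec.list_map (primrec_word.comp (Primrec.snd.comp Primrec.snd))
          (hsym.comp Primrec.snd).to₂)).to₂) (Primrec.const _))
  have h' : Primrec fun G : Grammar ar N => Encodable.encode G.enc :=
    (Primrec.encode_iff (f := fun G : Grammar ar N => G.enc.word)).2 h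
  exact Primrec.encode_iff.1 h'

theorem primrec_grammarsUpTo : Primrec (grammarsUpTo ar N) := by
  have h : Primrec fun m => (elems N).flatMap fun A => (termsUpTo ar N m).map (Prod.mk A) :=
    Primrec.list_flatMap (Primrec.const _) (Primrec.list_map
      (primrec_termsUpTo.comp Primrec.fst)
      (Primrec.pair (Primrec.snd.comp Primrec.fst) Primrec.snd).to₂).to₂
  exact Primrec.list_flatMap (Primrec.const _) (Primrec.list_map
    ((primrec_listsUpTo.comp h Primrec.id).comp Primrec.fst)
    (primrec_grammar_mk.comp (Primrec.snd.comp Primrec.fst) Primrec.snd).to₂).to₂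

end

end Enc

/-! ### Recognizability of the solution set and bounded search -/

section Automata

variable {Δ N : Type*} {ar : Δ → ℕ} {N' : Set N}

/-- The instances, each given by a list of automata for the expressions consistent with its
examples, and the meta-grammar. -/
abbrev AutomataProblem (ar : Δ → ℕ) (N : Type*) :=
  List (List (TreeAutomaton Δ)) × MetaGrammar ar N

/-- The expressions of the base language accepted by all automata in a list. -/
def solvers (G' : Grammar ar N') (as : List (TreeAutomaton Δ)) : Set (Tree ar) :=
  G'.language ∩ {e | ∀ a ∈ as, e ∈ a.language ar}

/-- `G` is a solution of the synthesis problem with instances given by automata. -/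
def IsAutomataSolution (G' : Grammar ar N') (D : AutomataProblem ar N) (G : Grammar ar N) : Prop :=
  G.StartFirst ∧ (∀ as ∈ D.1, ∃ e ∈ solvers G' as, e ∈ (G.extend G').language) ∧
    G.enc ∈ D.2.language

/-- A bound for the index of the set of expressions that solve an instance. -/
noncomputable def solversIndex (G' : Grammar ar N') (as : List (TreeAutomaton Δ)) : ℕ :=
  G'.index * (as.map (TreeAutomaton.index ar)).prod

theorem recognizable_solvers (G' : Grammar ar N') (as : List (TreeAutomaton Δ)) :
    Recognizable ar (solversIndex G' as) (solvers G' as) :=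
  G'.recognizable_language.inter
    (Recognizable.forall_mem_list TreeAutomaton.recognizable_language as)

/-- A bound for the index of the set of encodings of solutions. -/
noncomputable def solutionIndex (G' : Grammar ar N') (D : AutomataProblem ar N) : ℕ :=
  encIndex (Nat.card N) 1 *
    ((D.1.map fun as => encIndex (Nat.card N) (solversIndex G' as)).prod * D.2.index)

theorem recognizable_solutions [Finite N] (G' : Grammar ar N') (D : AutomataProblem ar N) :
    Recognizable (GrammarSymbol.arity ar) (solutionIndex G' D)
      {t : GrammarTree ar N | ∃ G, IsAutomataSolution G' D G ∧ G.enc = t} := by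
  have h := recognizable_startFirst.inter ((Recognizable.forall_mem_list (fun as =>
    recognizable_derives (N := N) (recognizable_solvers G' as) G'.liftProds) D.1).inter
      D.2.recognizable_language)
  rw [solutionIndex]
  convert h using 1
  ext t
  constructor
  · rintro ⟨G, ⟨hG, hs, he⟩, rfl⟩
    refine ⟨⟨G, hG, rfl⟩, fun as has => ?_, he⟩
    obtain ⟨e, he, hg⟩ := hs as has
    exact ⟨G, hG, ⟨e, he, Grammar.mem_language_iff.1 hg⟩, rfl⟩
  · rintro ⟨⟨G, hG, rfl⟩, hs, he⟩
    refine ⟨G, ⟨hG, fun as has => ?_, he⟩, rfl⟩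
    obtain ⟨G₂, hG₂, ⟨e, hmem, hg⟩, heq⟩ := hs as has
    obtain rfl := Grammar.enc_injOn hG₂ hG heq
    exact ⟨e, hmem, Grammar.mem_language_iff.2 hg⟩

variable [Finite Δ]

/-- Solvers lying in the extended language form an intersection of recognizable sets, so a smallest
one is bounded by the product of the indices. This turns adequacy of a given grammar into a finite
check. -/
theorem exists_solver_iff (G' : Grammar ar N') (as : List (TreeAutomaton Δ)) (G : Grammar ar N) :
    (∃ e ∈ solvers G' as, e ∈ (G.extend G').language) ↔
      ∃ e ∈ termsUpTo ar Empty
        ((arityBound ar + 1) ^ (solversIndex G' as * (G.extend G').index)),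
        (e ∈ G'.language ∧ ∀ a ∈ as, e ∈ a.language ar) ∧ e ∈ (G.extend G').language := by
  constructor
  · rintro ⟨e, he, hg⟩
    obtain ⟨e, ⟨he, hg⟩, hlen⟩ := ((recognizable_solvers G' as).inter
      (G.extend G').recognizable_language).exists_small (le_arityBound ar) ⟨e, he, hg⟩
    exact ⟨e, mem_termsUpTo.2 hlen, he, hg⟩
  · rintro ⟨e, -, he, hg⟩
    exact ⟨e, he, hg⟩

theorem primrec_extend [Primcodable Δ] [Primcodable N] (G' : Grammar ar N') :
    Primrec fun G : Grammar ar N => G.extend G' :=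
  primrec_grammar_mk.comp primrec_start (Primrec.list_append.comp primrec_prods (Primrec.const _))

theorem primrec_solversIndex [Primcodable Δ] (G' : Grammar ar N') :
    Primrec (solversIndex G') :=
  Primrec.nat_mul.comp (Primrec.const _) (primrec_prod.comp
    (Primrec.list_map Primrec.id (primrec_automaton_index.comp Primrec.snd).to₂))

variable [Finite N]

/-- A bound for the size of a smallest solution. -/
noncomputable def solutionBound (G' : Grammar ar N') (D : AutomataProblem ar N) : ℕ :=
  (arityBound (GrammarSymbol.arity ar : GrammarSymbol Δ N → ℕ) + 1) ^ solutionIndex G' D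

open Classical in
/-- A bounded search for a solution. -/
noncomputable def findSolution (G' : Grammar ar N') (D : AutomataProblem ar N) :
    Option (Grammar ar N) :=
  ((grammarsUpTo ar N (solutionBound G' D)).filter fun G => IsAutomataSolution G' D G).head?

theorem findSolution_eq_some {G' : Grammar ar N'} {D : AutomataProblem ar N} {G : Grammar ar N}
    (h : findSolution G' D = some G) : IsAutomataSolution G' D G := by
  have := List.mem_of_mem_head? h
  rw [List.mem_filter] at this
  simpa using this.2

theorem findSolution_eq_none {G' : Grammar ar N'} {D : AutomataProblem ar N}
    (h : findSolution G' D = none) : ¬ ∃ G, IsAutomataSolution G' D G := by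
  rintro ⟨G, hG⟩
  obtain ⟨_, ⟨G, hG, rfl⟩, hlen⟩ :=
    (recognizable_solutions G' D).exists_small (le_arityBound _) ⟨_, G, hG, rfl⟩
  rw [findSolution, List.head?_eq_none_iff, List.filter_eq_nil_iff] at h
  exact h G (mem_grammarsUpTo hlen) (by simpa using hG)

variable [Primcodable Δ] [Primcodable N]

theorem primrec_encIndex (v : ℕ) : Primrec (encIndex v) := by
  have h : Primrec fun n => v * n := Primrec.nat_mul.comp (Primrec.const v) Primrec.id
  have h2 : Primrec fun n => 2 ^ (v * n) := primrec_pow.comp (Primrec.const 2) h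
  exact primrec_pow.comp (Primrec.const 2) (Primrec.nat_add.comp (Primrec.nat_add.comp
    (Primrec.nat_add.comp (Primrec.const 1) (Primrec.nat_mul.comp h2 Primrec.id))
    (Primrec.nat_add.comp (Primrec.const 1) (Primrec.nat_add.comp (Primrec.const v)
      (Primrec.nat_mul.comp h2 h)))) (Primrec.const 1))

theorem primrec_solutionBound (G' : Grammar ar N') :
    Primrec (solutionBound G' : AutomataProblem ar N → ℕ) :=
  primrec_pow.comp (Primrec.const _) (Primrec.nat_mul.comp (Primrec.const _)
    (Primrec.nat_mul.comp (primrec_prod.comp (Primrec.list_map Primrec.fst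
      ((primrec_encIndex _).comp ((primrec_solversIndex G').comp Primrec.snd)).to₂))
      (primrec_grammar_index.comp Primrec.snd)))

theorem primrecPred_isAutomataSolution (G' : Grammar ar N') :
    PrimrecPred fun x : AutomataProblem ar N × Grammar ar N => IsAutomataSolution G' x.1 x.2 := by
  -- Any coding of N' will do, since the base grammar enters only as a constant.
  let _ : Primcodable N' := Primcodable.ofEquiv _ (Finite.equivFin N')
  have hext := primrec_extend G'
  refine (primrecPred_startFirst.comp Primrec.snd).and (PrimrecPred.and ?_ ?_)
  · simp only [exists_solver_iff]
    refine primrecPred_forall_mem (Primrec.fst.comp Primrec.fst)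
      (primrecPred_exists_mem ?_ (PrimrecPred.and (PrimrecPred.and ?_ ?_) ?_))
    · exact primrec_termsUpTo.comp (primrec_pow.comp (Primrec.const _) (Primrec.nat_mul.comp
        ((primrec_solversIndex G').comp Primrec.snd)
        (primrec_grammar_index.comp (hext.comp (Primrec.snd.comp Primrec.fst)))))
    · exact primrecPred_mem_grammar (Primrec.const G') Primrec.snd
    · exact primrecPred_forall_mem (Primrec.snd.comp Primrec.fst)
        (primrecPred_mem_automaton Primrec.snd (Primrec.snd.comp Primrec.fst))
    · exact primrecPred_mem_grammar (hext.comp (Primrec.snd.comp (Primrec.fst.comp Primrec.fst)))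
        Primrec.snd
  · exact primrecPred_mem_grammar (Primrec.snd.comp Primrec.fst) (primrec_enc.comp Primrec.snd)

theorem primrec_findSolution (G' : Grammar ar N') :
    Primrec (findSolution G' : AutomataProblem ar N → Option (Grammar ar N)) := by
  classical
  refine Primrec.list_head?.comp (primrec_filter
    (primrec_grammarsUpTo.comp (primrec_solutionBound G')) ?_)
  exact primrecPred_isAutomataSolution G'

end Automata

/-! ### From base languages to automata -/

section BaseLanguage

variable {Δ N 𝓜 : Type*} {ar : Δ → ℕ} {N' : Set N}

/-- Training and testing examples play the same role, so their lists are concatenated. The explicit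
factor L(G') in `solvers` matters for an instance without examples, where no automaton enforces it.
-/
theorem BaseLanguage.isSolution_iff {B : BaseLanguage ar N' 𝓜} {A : 𝓜 → TreeAutomaton Δ}
    (hA : ∀ M, (A M).language ar =
      {e | ∃ h : e ∈ B.grammar.language, B.consistent ⟨e, h⟩ M})
    {Is : List (LearningInstance 𝓜)} {𝒢 : MetaGrammar ar N} {G : Grammar ar N} :
    B.IsSolution Is 𝒢 G ↔
      IsAutomataSolution B.grammar (Is.map fun I => (I.1 ++ I.2).map A, 𝒢) G := by
  have hI : ∀ I : LearningInstance 𝓜,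
      (∃ e : B.grammar.language, e.1 ∈ (G.extend B.grammar).language ∧ B.Solves e I) ↔
        ∃ e ∈ solvers B.grammar ((I.1 ++ I.2).map A), e ∈ (G.extend B.grammar).language := by
    intro I
    constructor
    · rintro ⟨⟨e, he⟩, hg, h1, h2⟩
      refine ⟨e, ⟨he, fun a ha => ?_⟩, hg⟩
      obtain ⟨M, hM, rfl⟩ := List.mem_map.1 ha
      rw [hA]
      exact ⟨he, (List.mem_append.1 hM).elim (h1 M) (h2 M)⟩
    · rintro ⟨e, ⟨he, h⟩, hg⟩
      have h' : ∀ M ∈ I.1 ++ I.2, B.consistent ⟨e, he⟩ M := by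
        intro M hM
        have := h _ (List.mem_map_of_mem hM)
        rw [hA] at this
        exact this.2
      exact ⟨⟨e, he⟩, hg, fun M hM => h' M (List.mem_append_left _ hM),
        fun M hM => h' M (List.mem_append_right _ hM)⟩
  constructor
  · rintro ⟨h1, h2, h3⟩
    exact ⟨h1, List.forall_mem_map.2 fun I h => (hI I).1 (h2 I h), h3⟩
  · rintro ⟨h1, h2, h3⟩
    exact ⟨h1, fun I h => (hI I).2 (List.forall_mem_map.1 h2 I h), h3⟩

end BaseLanguage

end DSLSynth

theorem mainTheorem1 {Δ N 𝓜 : Type*} [Finite Δ] [Primcodable Δ] [Finite N] [Primcodable N]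
    [Primcodable 𝓜] (ar : Δ → ℕ) (N' : Set N) (B : DSLSynth.BaseLanguage ar N' 𝓜)
    (hB : B.TreeAutomatonComputable) :
    -- existence of a solution is decidable
    (ComputablePred fun p : List (DSLSynth.LearningInstance 𝓜) × DSLSynth.MetaGrammar ar N =>
      ∃ G, B.IsSolution p.1 p.2 G) ∧
    -- an algorithm outputs a solution, or reports that there is none
    (∃ synth : List (DSLSynth.LearningInstance 𝓜) × DSLSynth.MetaGrammar ar N →
        Option (DSLSynth.Grammar ar N),
      Computable synth ∧
      ∀ p, (∀ G, synth p = some G → B.IsSolution p.1 p.2 G) ∧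
        (synth p = none → ¬ ∃ G, B.IsSolution p.1 p.2 G)) ∧
    -- the set of encodings of solutions is a regular set of trees
    ∀ (Is : List (DSLSynth.LearningInstance 𝓜)) (𝒢 : DSLSynth.MetaGrammar ar N),
      DSLSynth.IsRegularTreeLanguage (DSLSynth.GrammarSymbol.arity ar)
        {t : DSLSynth.GrammarTree ar N | ∃ G, B.IsSolution Is 𝒢 G ∧ G.enc = t} := by
  obtain ⟨A, A', hAc, -, hA⟩ := hB
  have hsol := fun Is 𝒢 G => B.isSolution_iff (fun M => (hA M).1) (Is := Is) (𝒢 := 𝒢) (G := G)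
  let D : List (DSLSynth.LearningInstance 𝓜) × DSLSynth.MetaGrammar ar N →
      DSLSynth.AutomataProblem ar N := fun p => (p.1.map fun I => (I.1 ++ I.2).map A, p.2)
  have hD : Computable D :=
    Computable.pair ((DSLSynth.computable_list_map ((DSLSynth.computable_list_map hAc).comp
      (Computable.list_append.comp Computable.fst Computable.snd))).comp Computable.fst)
      Computable.snd
  have hsynth : Computable fun p => DSLSynth.findSolution B.grammar (D p) :=
    (DSLSynth.primrec_findSolution B.grammar).to_comp.comp hD
  have hsome : ∀ p G, DSLSynth.findSolution B.grammar (D p) = some G →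
      B.IsSolution p.1 p.2 G :=
    fun p G h => (hsol _ _ _).2 (DSLSynth.findSolution_eq_some h)
  have hnone : ∀ p, DSLSynth.findSolution B.grammar (D p) = none →
      ¬ ∃ G, B.IsSolution p.1 p.2 G :=
    fun p h ⟨G, hG⟩ => DSLSynth.findSolution_eq_none h ⟨G, (hsol _ _ _).1 hG⟩
  refine ⟨?_, ⟨_, hsynth, fun p => ⟨hsome p, hnone p⟩⟩, fun Is 𝒢 => ?_⟩
  -- The decision procedure asks whether the search returned anything.
  · refine ComputablePred.computable_iff.2
      ⟨_, Primrec.option_isSome.to_comp.comp hsynth, funext fun p => propext ?_⟩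
    cases h : DSLSynth.findSolution B.grammar (D p) with
    | none => simpa using hnone p h
    | some G => simpa using ⟨G, hsome p G h⟩
  · simp only [hsol]
    exact (DSLSynth.recognizable_solutions B.grammar _).isRegularTreeLanguage
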